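/- Let $R$ be an associative ring with identity. Modules are left $R$-modules unless stated otherwise, and complexes are $\mathbb{Z}$-indexed cochain complexes of modules. Definitions. * A sequence $0\to A\to B\to C\to 0$ of modules is *pure exact* if it is exact and stays exact under $M\otimes_R-$ for every right $R$-module $M$; then $A\to B$ is *pure monic* and $B\to C$ is *pure epic*. A module is *pure projective* (resp. *pure injective*) if it is projective (resp. injective) with respect to all pure exact sequences. * A complex $X$ is *pure exact at* $k$ if each of $d_X^{k-1}$ and $d_X^{k}$ is a pure epic followed by a pure monic and $0\to\operatorname{Ker} d_X^{k}\to X^k\to\operatorname{Coker} d_X^{k-1}\to 0$ is pure exact. It is *pure exact* if this holds for all $k\in\mathbb{Z}$. In the extended integers put $\inf_p X=\inf\{k\in\mathbb{Z} : X \text{ is not pure exact at } k\}$ and $\sup_p X=\sup\{k\in\mathbb{Z} : X \text{ is not pure exact at } k\}$, so that $\inf_pX=\infty$ and $\sup_pX=-\infty$ if $X$ is pure exact. * A cochain map is a *pure quasi-isomorphism* if its mapping cone is pure exact. $\mathbf{D}^b_{pur}(R)$ is the quotient of the bounded homotopy category $\mathbf{K}^b(R)$ by the pure exact bounded complexes;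 its objects are the bounded complexes. * For complexes $X,Y$, $\operatorname{Hom}_R(X,Y)$ is the total Hom complex, with $\prod_{j}\operatorname{Hom}_R(X^j,Y^{j+k})$ in degree $k$. A *pure projective resolution* of $X$ is a pure quasi-isomorphism $P\to X$ with all $P^i$ pure projective and such that $\operatorname{Hom}_R(P,-)$ sends pure exact complexes to pure exact complexes of $\mathbb{Z}$-modules. A *pure injective resolution* of $Y$ is a pure quasi-isomorphism $Y\to I$ with all $I^i$ pure injective and such that $\operatorname{Hom}_R(-,I)$ sends pure exact complexes to pure exact complexes of $\mathbb{Z}$-modules. * $\operatorname{ppd}X$ is the infimum, in the extended integers, of the $m\in\mathbb{Z}$ for which $X$ has a pure projective resolution $P\to X$ with $P^i=0$ for all $i<-m$; $\operatorname{pid}Y$ is the infimum of the $m\in\mathbb{Z}$ for which $Y$ has a pure injective resolution $Y\to I$ with $I^i=0$ for all $i>m$. * For bounded $X,Y$ and $i\in\mathbb{Z}$, $\operatorname{Pext}^i_R(X,Y)=H^i\operatorname{Hom}_R(P,Y)$, where $P\to X$ is any pure projective resolution. * The *left pure global dimension* of $R$ is the supremum of $\operatorname{ppd}M$ over all left $R$-modules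 $M$, regarded as complexes concentrated in degree $0$. Theorem. For every $n\in\mathbb{Z}$ the following statements are equivalent: 1. the left pure global dimension of $R$ is at most $n$; 2. $\operatorname{ppd} X\le n-\inf_p X$ for all $X\in\mathbf{D}^b_{pur}(R)$; 3. $\operatorname{pid} Y\le n+\sup_p Y$ for all $Y\in\mathbf{D}^b_{pur}(R)$; 4. $\operatorname{Pext}^i_R(X,Y)=0$ for all $X,Y\in\mathbf{D}^b_{pur}(R)$ and all integers $i>n+\sup_p Y-\inf_p X$. -/

import Mathlib

open CategoryTheory CategoryTheory.Limits
open scoped TensorProduct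

universe u v

noncomputable section

namespace PureDerived


section Tensor

variable {R : Type v} [Ring R] (M : Type u) [AddCommGroup M] [Module Rᵐᵒᵖ M]

/-- The subgroup of `M ⊗_ℤ A` generated by the elements `(m r) ⊗ a - m ⊗ (r a)`, for a right
`R`-module `M` and a left `R`-module `A`. -/
def balancing (A : Type u) [AddCommGroup A] [Module R A] : AddSubgroup (M ⊗[ℤ] A) :=
  AddSubgroup.closure {x | ∃ (m : M) (r : R) (a : A),
    x = (MulOpposite.op r • m) ⊗ₜ[ℤ] a - m ⊗ₜ[ℤ] (r • a)}

/-- The abelian group `M ⊗_R A` for a right `R`-module `M` and a left `R`-module `A` over a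
not necessarily commutative ring `R`. -/
abbrev RTensor (A : Type u) [AddCommGroup A] [Module R A] : Type u :=
  (M ⊗[ℤ] A) ⧸ balancing (R := R) M A

variable {A B : Type u} [AddCommGroup A] [Module R A] [AddCommGroup B] [Module R B]

theorem balancing_le_comap (f : A →ₗ[R] B) :
    balancing (R := R) M A ≤ (balancing (R := R) M B).comap
      (LinearMap.lTensor M f.toAddMonoidHom.toIntLinearMap).toAddMonoidHom := by
  refine (AddSubgroup.closure_le _).2 ?_
  rintro _ ⟨m, r, a, rfl⟩
  refine AddSubgroup.subset_closure ⟨m, r, f a, ?_⟩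
  simp

/-- The homomorphism `M ⊗_R f : M ⊗_R A → M ⊗_R B`. -/
def RTensor.map (f : A →ₗ[R] B) : RTensor (R := R) M A →+ RTensor (R := R) M B :=
  QuotientAddGroup.map _ _ (LinearMap.lTensor M f.toAddMonoidHom.toIntLinearMap).toAddMonoidHom
    (balancing_le_comap M f)

end Tensor

section Purity

variable {R : Type v} [Ring R] {A B C : Type u} [AddCommGroup A] [Module R A]
  [AddCommGroup B] [Module R B] [AddCommGroup C] [Module R C]

/-- `0 → A → B → C → 0` is a pure exact sequence of left `R`-modules: it is exact, and remains
exact after applying `M ⊗_R -` for every right `R`-module `M`. -/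
structure IsPureShortExact (f : A →ₗ[R] B) (g : B →ₗ[R] C) : Prop where
  injective : Function.Injective f
  exact : Function.Exact f g
  surjective : Function.Surjective g
  tensor_injective : ∀ (M : Type u) [AddCommGroup M] [Module Rᵐᵒᵖ M],
    Function.Injective (RTensor.map M f)
  tensor_exact : ∀ (M : Type u) [AddCommGroup M] [Module Rᵐᵒᵖ M],
    Function.Exact (RTensor.map M f) (RTensor.map M g)
  tensor_surjective : ∀ (M : Type u) [AddCommGroup M] [Module Rᵐᵒᵖ M],
    Function.Surjective (RTensor.map M g)

/-- `f` is pure monic: it is the left-hand map of a pure exact sequence, whose right-hand map is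
then (up to isomorphism) the cokernel of `f`. -/
def IsPureMono (f : A →ₗ[R] B) : Prop :=
  IsPureShortExact f (LinearMap.range f).mkQ

/-- `g` is pure epic: it is the right-hand map of a pure exact sequence, whose left-hand map is
then (up to isomorphism) the kernel of `g`. -/
def IsPureEpi (g : B →ₗ[R] C) : Prop :=
  IsPureShortExact (LinearMap.ker g).subtype g

/-- `d` decomposes as a pure epic followed by a pure monic. -/
def IsPureAdmissible (d : A →ₗ[R] B) : Prop :=
  ∃ (D : ModuleCat.{u} R) (p : A →ₗ[R] D) (i : D →ₗ[R] B),
    IsPureEpi p ∧ IsPureMono i ∧ i ∘ₗ p = d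

/-- Pure exactness at `B` of a piece `A → B → C` of a complex: both differentials decompose as a
pure epic followed by a pure monic, and `0 → Ker e → B → Coker d → 0` is pure exact. -/
structure IsPureExactPair (d : A →ₗ[R] B) (e : B →ₗ[R] C) : Prop where
  admissible_left : IsPureAdmissible d
  admissible_right : IsPureAdmissible e
  shortExact : IsPureShortExact (LinearMap.ker e).subtype (LinearMap.range d).mkQ

end Purity

section Modules

variable {R : Type v} [Ring R]

/-- `M` is pure projective: projective with respect to pure exact sequences. -/
def IsPureProjective (M : ModuleCat.{u} R) : Prop :=
  ∀ (A B C : ModuleCat.{u} R) (f : A →ₗ[R] B) (g : B →ₗ[R] C), IsPureShortExact f g →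
    ∀ h : M →ₗ[R] C, ∃ k : M →ₗ[R] B, g ∘ₗ k = h

/-- `M` is pure injective: injective with respect to pure exact sequences. -/
def IsPureInjective (M : ModuleCat.{u} R) : Prop :=
  ∀ (A B C : ModuleCat.{u} R) (f : A →ₗ[R] B) (g : B →ₗ[R] C), IsPureShortExact f g →
    ∀ h : A →ₗ[R] M, ∃ k : B →ₗ[R] M, k ∘ₗ f = h

end Modules

section Complexes

variable {R : Type v} [Ring R]

/-- The complex `X` is pure exact at `n`. -/
def PureExactAt (X : CochainComplex (ModuleCat.{u} R) ℤ) (n : ℤ) : Prop :=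
  IsPureExactPair (X.d (n - 1) n).hom (X.d n (n + 1)).hom

/-- The complex `X` is pure exact. -/
def PureExact (X : CochainComplex (ModuleCat.{u} R) ℤ) : Prop :=
  ∀ n : ℤ, PureExactAt X n

/-- Pure exactness of a complex of abelian groups, i.e. of `ℤ`-modules. -/
def PureExactAb (X : CochainComplex AddCommGrpCat.{u} ℤ) : Prop :=
  ∀ n : ℤ, IsPureExactPair (X.d (n - 1) n).hom.toIntLinearMap (X.d n (n + 1)).hom.toIntLinearMap

/-- `f` is a pure quasi-isomorphism: its mapping cone is pure exact. -/
def IsPureQuasiIso {X Y : CochainComplex (ModuleCat.{u} R) ℤ} (f : X ⟶ Y) : Prop :=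
  PureExact (CochainComplex.mappingCone f)

/-- `X` is a bounded complex. The bounded complexes are the objects of the bounded homotopy
category and of its quotient, the bounded pure derived category. -/
def IsBounded (X : CochainComplex (ModuleCat.{u} R) ℤ) : Prop :=
  ∃ a b : ℤ, ∀ i : ℤ, (i < a ∨ b < i) → IsZero (X.X i)

/-- The infimum of the degrees in which `X` is not pure exact, in the extended line
(`⊤` if `X` is pure exact, `⊥` if there are arbitrarily small such degrees). -/
def infP (X : CochainComplex (ModuleCat.{u} R) ℤ) : EReal :=
  ⨅ (n : ℤ) (_ : ¬ PureExactAt X n), ((n : ℝ) : EReal)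

/-- The supremum of the degrees in which `X` is not pure exact, in the extended line
(`⊥` if `X` is pure exact, `⊤` if there are arbitrarily large such degrees). -/
def supP (X : CochainComplex (ModuleCat.{u} R) ℤ) : EReal :=
  ⨆ (n : ℤ) (_ : ¬ PureExactAt X n), ((n : ℝ) : EReal)

/-- A pure projective resolution of `X`: a pure quasi-isomorphism `P ⟶ X`, where `P` is a complex
of pure projective modules such that the total Hom complex functor `Hom_R(P, -)` preserves pure
exact complexes. -/
structure PureProjectiveResolution (X : CochainComplex (ModuleCat.{u} R) ℤ) where
  /-- the resolving complex -/
  complex : CochainComplex (ModuleCat.{u} R) ℤ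
  /-- the augmentation -/
  π : complex ⟶ X
  isPureQuasiIso : IsPureQuasiIso π
  isPureProjective : ∀ i : ℤ, IsPureProjective (complex.X i)
  preserves : ∀ Z : CochainComplex (ModuleCat.{u} R) ℤ, PureExact Z →
    PureExactAb (CochainComplex.HomComplex complex Z)

/-- A pure injective resolution of `Y`: a pure quasi-isomorphism `Y ⟶ I`, where `I` is a complex
of pure injective modules such that the total Hom complex functor `Hom_R(-, I)` preserves pure
exact complexes. -/
structure PureInjectiveResolution (Y : CochainComplex (ModuleCat.{u} R) ℤ) where
  /-- the resolving complex -/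
  complex : CochainComplex (ModuleCat.{u} R) ℤ
  /-- the coaugmentation -/
  ι : Y ⟶ complex
  isPureQuasiIso : IsPureQuasiIso ι
  isPureInjective : ∀ i : ℤ, IsPureInjective (complex.X i)
  preserves : ∀ Z : CochainComplex (ModuleCat.{u} R) ℤ, PureExact Z →
    PureExactAb (CochainComplex.HomComplex Z complex)

/-- `X` has pure projective dimension at most the integer `n`. -/
def HasPpdLE (X : CochainComplex (ModuleCat.{u} R) ℤ) (n : ℤ) : Prop :=
  ∃ P : PureProjectiveResolution X, ∀ i : ℤ, i < -n → IsZero (P.complex.X i)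

/-- `Y` has pure injective dimension at most the integer `n`. -/
def HasPidLE (Y : CochainComplex (ModuleCat.{u} R) ℤ) (n : ℤ) : Prop :=
  ∃ I : PureInjectiveResolution Y, ∀ i : ℤ, n < i → IsZero (I.complex.X i)

/-- The pure projective dimension, with values in `ℤ ∪ {±∞}`. -/
def ppd (X : CochainComplex (ModuleCat.{u} R) ℤ) : EReal :=
  ⨅ (n : ℤ) (_ : HasPpdLE X n), ((n : ℝ) : EReal)

/-- The pure injective dimension, with values in `ℤ ∪ {±∞}`. -/
def pid (Y : CochainComplex (ModuleCat.{u} R) ℤ) : EReal :=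
  ⨅ (n : ℤ) (_ : HasPidLE Y n), ((n : ℝ) : EReal)

/-- `Pext_R^i(X, Y) = H^i(Hom_R(P, Y))`, computed with the pure projective resolution `P ⟶ X`. -/
def PureProjectiveResolution.Pext {X : CochainComplex (ModuleCat.{u} R) ℤ}
    (P : PureProjectiveResolution X) (Y : CochainComplex (ModuleCat.{u} R) ℤ) (i : ℤ) :
    AddCommGrpCat.{u} :=
  (CochainComplex.HomComplex P.complex Y).homology i

end Complexes

/-- The left pure global dimension of `R`: the supremum of the pure projective dimensions of all
left `R`-modules, regarded as complexes concentrated in degree `0`. -/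
def pureGlobalDim (R : Type u) [Ring R] : EReal :=
  ⨆ M : ModuleCat.{u} R,
    ppd ((HomologicalComplex.single (ModuleCat.{u} R) (ComplexShape.up ℤ) 0).obj M)

end PureDerived

end

-- The argument rests on an elementary form of purity: `0 → A → B → C → 0` is pure exactly when
-- finite linear systems with constants in `A` that are solvable in `B` are solvable in `A`,
-- equivalently when solutions in `C` of finite homogeneous systems lift to `B`. Finitely presented
-- modules represent solutions of systems, so their direct sums cover every module purely, and
-- double character modules give pure embeddings into pure injectives. Hence a complex is pure exact
-- iff `Hom(P, -)` makes it exact for all pure projective `P`, and iff `Hom(-, E)` does so for all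
-- pure injective `E`. In the homotopy category the pure exact complexes are a right orthogonal, and
-- Hom out of a K-pure projective complex or into a K-pure injective one does not change along pure
-- quasi-isomorphisms.
--
-- The equivalence is proved as 1 → 3 → 4 → 2 → 1. 1 → 3 (`hasPidLE_of_forall_single`): let `Y → I`
-- be a bounded below pure injective resolution and `P → C` a resolution of any module with `P` in
-- degrees `≥ -n`. Then `Hom(C, I)`, `Hom(P, I)`, `Hom(P, Y)` and `Hom(P, τ_{≤ s} Y)` have the same
-- cohomology, which vanishes above `n + s`. As `C` is arbitrary, `τ_{≤ n+s} I` still has pure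
-- injective terms, and it resolves `Y`. 3 → 4 (`homVanishes_of_hasPidLE`): replace `Y` by a short
-- pure injective resolution and `X` by `τ_{≥ c} X`, and compare degrees. 4 → 2
-- (`hasPpdLE_of_homVanishes`): vanishing against all modules makes the truncation `τ_{≥ -m}` of a
-- pure projective resolution again pure projective. 2 → 1: a module in degree `0` has `inf_p ≥ 0`.
--
-- Resolutions must also make Hom complexes pure exact over `ℤ`. A solution of an integral system in
-- `Hom(X, Y)` is a cochain from `X` to the complex of solutions in `Y`, which reduces purity to
-- ordinary vanishing.

universe w

noncomputable section

namespace PureDerived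

/-! ### Purity in terms of finite systems of linear equations -/

section Systems

variable {R : Type v} [Ring R] {A B C : Type*} [AddCommGroup A] [Module R A]
  [AddCommGroup B] [Module R B] [AddCommGroup C] [Module R C]

/-- Solutions in `C` of finite homogeneous systems of linear equations lift along `g` to solutions
in `B`. -/
def LiftsSystems (g : B →ₗ[R] C) : Prop :=
  ∀ (ι κ : Type) [Fintype ι] [Fintype κ] (r : ι → κ → R) (c : κ → C),
    (∀ i, ∑ j, r i j • c j = 0) →
      ∃ b : κ → B, (∀ j, g (b j) = c j) ∧ ∀ i, ∑ j, r i j • b j = 0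

/-- A finite system of linear equations with constants in `A` which is solvable in `B` is solvable
in `A`. -/
def SolvesSystems (f : A →ₗ[R] B) : Prop :=
  ∀ (ι κ : Type) [Fintype ι] [Fintype κ] (r : ι → κ → R) (a : ι → A) (b : κ → B),
    (∀ i, ∑ j, r i j • b j = f (a i)) → ∃ x : κ → A, ∀ i, ∑ j, r i j • x j = a i

theorem SolvesSystems.injective {f : A →ₗ[R] B} (h : SolvesSystems f) :
    Function.Injective f := by
  rw [injective_iff_map_eq_zero]
  intro a ha
  -- One equation without unknowns: its solvability in `A` says `0 = a`.
  obtain ⟨x, hx⟩ := h Unit Empty (fun _ e => e.elim) (fun _ => a) (fun e => e.elim) (by simp [ha])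
  simpa using (hx ()).symm

/-- Lift the solution arbitrarily. The defects of the equations lie in `A`, and solving the system
with these defects as constants yields the correction. -/
theorem SolvesSystems.liftsSystems {f : A →ₗ[R] B} {g : B →ₗ[R] C} (h : SolvesSystems f)
    (hfg : Function.Exact f g) (hg : Function.Surjective g) : LiftsSystems g := by
  intro ι κ _ _ r c hc
  choose b hb using fun j => hg (c j)
  have : ∀ i, ∃ a, f a = ∑ j, r i j • b j := fun i => (hfg _).1 (by simp [hb, hc])
  choose a ha using this
  obtain ⟨x, hx⟩ := h ι κ r a b fun i => (ha i).symm
  refine ⟨fun j => b j - f (x j), fun j => ?_, fun i => ?_⟩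
  · simp [hb, hfg.apply_apply_eq_zero]
  · simp only [smul_sub, Finset.sum_sub_distrib, ← ha i, ← hx i, map_sum, map_smul, sub_self]

theorem LiftsSystems.solvesSystems {f : A →ₗ[R] B} {g : B →ₗ[R] C} (h : LiftsSystems g)
    (hf : Function.Injective f) (hfg : Function.Exact f g) : SolvesSystems f := by
  intro ι κ _ _ r a b hb
  obtain ⟨b', hb', hr⟩ := h ι κ r (fun j => g (b j)) fun i => by
    simp_rw [← map_smul, ← map_sum, hb, hfg.apply_apply_eq_zero]
  have : ∀ j, ∃ x, f x = b j - b' j := fun j => (hfg _).1 (by simp [hb'])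
  choose x hx using this
  refine ⟨x, fun i => hf ?_⟩
  simp [hx, smul_sub, hr, hb]

theorem SolvesSystems.of_comp {D : Type*} [AddCommGroup D] [Module R D] {g : B →ₗ[R] C}
    {h : C →ₗ[R] D} (H : SolvesSystems (h ∘ₗ g)) : SolvesSystems g := by
  intro ι κ _ _ r a b hb
  exact H ι κ r a (fun j => h (b j)) fun i => by
    simp_rw [← map_smul, ← map_sum, hb, LinearMap.comp_apply]

end Systems

/-! ### Tensor products over a noncommutative ring and the vanishing of tensors -/

section Tensor

variable {R : Type v} [Ring R] (M : Type u) [AddCommGroup M] [Module Rᵐᵒᵖ M]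
  {A B C : Type u} [AddCommGroup A] [Module R A] [AddCommGroup B] [Module R B]
  [AddCommGroup C] [Module R C]

/-- The class of `m ⊗ a` in `M ⊗_R A`. -/
def RTensor.tmul (m : M) (a : A) : RTensor (R := R) M A :=
  QuotientAddGroup.mk (m ⊗ₜ[ℤ] a)

variable {M}

theorem RTensor.smul_tmul (m : M) (r : R) (a : A) :
    RTensor.tmul (R := R) M (MulOpposite.op r • m) a = RTensor.tmul M m (r • a) := by
  rw [← sub_eq_zero]
  exact (QuotientAddGroup.eq_zero_iff _).2 (AddSubgroup.subset_closure ⟨m, r, a, rfl⟩)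

theorem RTensor.map_tmul (f : A →ₗ[R] B) (m : M) (a : A) :
    RTensor.map M f (RTensor.tmul M m a) = RTensor.tmul M m (f a) := rfl

theorem RTensor.tmul_add (m : M) (a b : A) :
    RTensor.tmul (R := R) M m (a + b) = RTensor.tmul M m a + RTensor.tmul M m b := by
  simp only [RTensor.tmul, TensorProduct.tmul_add]; rfl

theorem RTensor.add_tmul (m m' : M) (a : A) :
    RTensor.tmul (R := R) M (m + m') a = RTensor.tmul M m a + RTensor.tmul M m' a := by
  simp only [RTensor.tmul, TensorProduct.add_tmul]; rfl

variable (M) in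
/-- The biadditive map `(m, a) ↦ m ⊗ a`. -/
def RTensor.mkHom : M →+ A →+ RTensor (R := R) M A :=
  AddMonoidHom.mk' (fun m => AddMonoidHom.mk' (RTensor.tmul M m) (RTensor.tmul_add m))
    fun m m' => by ext a; exact RTensor.add_tmul m m' a

@[simp]
theorem RTensor.mkHom_apply (m : M) (a : A) :
    RTensor.mkHom (R := R) M m a = RTensor.tmul M m a := rfl

/-- The universal property of `M ⊗_R A`. -/
def RTensor.lift {G : Type*} [AddCommGroup G] (φ : M →+ A →+ G)
    (h : ∀ (m : M) (r : R) (a : A), φ (MulOpposite.op r • m) a = φ m (r • a)) :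
    RTensor (R := R) M A →+ G :=
  QuotientAddGroup.lift _ (TensorProduct.liftAddHom φ fun z m a => by simp) (by
    refine (AddSubgroup.closure_le _).2 ?_
    rintro _ ⟨m, r, a, rfl⟩
    simp [h])

theorem RTensor.lift_tmul {G : Type*} [AddCommGroup G] (φ : M →+ A →+ G)
    (h : ∀ (m : M) (r : R) (a : A), φ (MulOpposite.op r • m) a = φ m (r • a)) (m : M) (a : A) :
    RTensor.lift φ h (RTensor.tmul M m a) = φ m a := by
  rfl

theorem RTensor.induction {p : RTensor (R := R) M A → Prop} (zero : p 0)
    (tmul : ∀ m a, p (RTensor.tmul M m a)) (add : ∀ x y, p x → p y → p (x + y)) (x) : p x := by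
  obtain ⟨x, rfl⟩ := QuotientAddGroup.mk_surjective x
  induction x using TensorProduct.induction_on with
  | zero => exact zero
  | tmul m a => exact tmul m a
  | add x y hx hy => exact add _ _ hx hy

theorem RTensor.map_surjective {g : B →ₗ[R] C} (hg : Function.Surjective g) :
    Function.Surjective (RTensor.map M g) := by
  intro x
  induction x using RTensor.induction with
  | zero => exact ⟨0, map_zero _⟩
  | tmul m c =>
    obtain ⟨b, rfl⟩ := hg c
    exact ⟨_, RTensor.map_tmul g m b⟩
  | add x y hx hy =>
    obtain ⟨x, rfl⟩ := hx
    obtain ⟨y, rfl⟩ := hy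
    exact ⟨x + y, map_add _ _ _⟩

/-- A set-theoretic section of `g` induces a homomorphism from `M ⊗ C` to the cokernel of `M ⊗ f`,
since two lifts of an element of `C` differ by an element of `A`. It recovers the class of `x` from
its image in `M ⊗ C`. -/
theorem RTensor.map_exact {f : A →ₗ[R] B} {g : B →ₗ[R] C} (hfg : Function.Exact f g)
    (hg : Function.Surjective g) : Function.Exact (RTensor.map M f) (RTensor.map M g) := by
  intro x
  constructor
  · intro hx
    let Q := RTensor (R := R) M B ⧸ (RTensor.map M f).range
    choose s hs using hg
    have key : ∀ (m : M) (b b' : B), g b = g b' →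
        (QuotientAddGroup.mk (RTensor.tmul M m b) : Q) = QuotientAddGroup.mk (RTensor.tmul M m b') := by
      intro m b b' h
      obtain ⟨a, ha⟩ := (hfg (-b + b')).1 (by simp [h])
      refine QuotientAddGroup.eq.2 ⟨RTensor.tmul M m a, ?_⟩
      rw [RTensor.map_tmul, ha]
      simp only [← RTensor.mkHom_apply, map_add, map_neg]
    let φ : M →+ C →+ Q := AddMonoidHom.mk' (fun m => AddMonoidHom.mk'
      (fun c => QuotientAddGroup.mk (RTensor.tmul M m (s c)))
      (fun c c' => by
        rw [← QuotientAddGroup.mk_add, ← RTensor.tmul_add]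
        exact key _ _ _ (by simp [hs])))
      (fun m m' => by ext c; simp [RTensor.add_tmul])
    have hφ (m : M) (r : R) (c : C) : φ (MulOpposite.op r • m) c = φ m (r • c) := by
      simp only [φ, AddMonoidHom.mk'_apply, RTensor.smul_tmul]
      exact key _ _ _ (by simp [hs])
    have h : ∀ y, RTensor.lift φ hφ (RTensor.map M g y) = QuotientAddGroup.mk y := by
      intro y
      induction y using RTensor.induction with
      | zero => simp
      | tmul m b =>
        rw [RTensor.map_tmul, RTensor.lift_tmul]
        exact key _ _ _ (by simp [hs])
      | add x y hx hy => simp only [map_add, hx, hy, QuotientAddGroup.mk_add]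
    have := h x
    rw [hx, map_zero] at this
    exact (QuotientAddGroup.eq_zero_iff _).1 this.symm
  · rintro ⟨y, rfl⟩
    induction y using RTensor.induction with
    | zero => simp
    | tmul m a => 
      rw [RTensor.map_tmul, RTensor.map_tmul, hfg.apply_apply_eq_zero, ← RTensor.mkHom_apply,
        map_zero]
    | add x y hx hy => simp only [map_add, hx, hy, add_zero]

variable (R M A) in
/-- The relations between the pure tensors of `M ⊗_R A`, as a subgroup of the formal sums. -/
def tensorRelations : AddSubgroup (M →₀ A) :=
  AddSubgroup.closure {x | ∃ (g : M →₀ R) (a : A), (g.sum fun m r => MulOpposite.op r • m) = 0 ∧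
    x = g.mapRange (fun r => r • a) (zero_smul R a)}

theorem mem_tensorRelations {x : M →₀ A} (hx : x ∈ tensorRelations R M A) :
    ∃ (κ : Type) (_ : Fintype κ) (g : κ → M →₀ R) (a : κ → A),
      (∀ k, ((g k).sum fun m r => MulOpposite.op r • m) = 0) ∧
        x = ∑ k, (g k).mapRange (fun r => r • a k) (zero_smul R (a k)) := by
  induction hx using AddSubgroup.closure_induction with
  | mem x hx =>
    obtain ⟨g, a, hg, rfl⟩ := hx
    exact ⟨Unit, inferInstance, fun _ => g, fun _ => a, fun _ => hg, by simp⟩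
  | zero => exact ⟨Empty, inferInstance, fun e => e.elim, fun e => e.elim, fun e => e.elim, by simp⟩
  | add x y _ _ hx hy =>
    obtain ⟨κ, _, g, a, hg, rfl⟩ := hx
    obtain ⟨κ', _, g', a', hg', rfl⟩ := hy
    refine ⟨κ ⊕ κ', inferInstance, Sum.elim g g', Sum.elim a a', ?_, ?_⟩
    · rintro (k | k)
      exacts [hg k, hg' k]
    · simp
  | neg x _ hx =>
    obtain ⟨κ, _, g, a, hg, rfl⟩ := hx
    refine ⟨κ, inferInstance, g, -a, hg, ?_⟩
    rw [← Finset.sum_neg_distrib]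
    refine Finset.sum_congr rfl fun k _ => ?_
    ext m
    simp

variable (R M A) in
/-- The class of a formal sum of pure tensors. -/
def tensorSum : (M →₀ A) →+ RTensor (R := R) M A :=
  Finsupp.liftAddHom fun m => RTensor.mkHom M m

theorem tensorSum_single (m : M) (a : A) :
    tensorSum R M A (Finsupp.single m a) = RTensor.tmul M m a := by
  exact Finsupp.liftAddHom_apply_single _ m a

theorem tensorSum_eq_zero {x : M →₀ A} (hx : x ∈ tensorRelations R M A) :
    tensorSum R M A x = 0 := by
  refine (AddSubgroup.closure_le (tensorSum R M A).ker).2 ?_ hx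
  rintro _ ⟨g, a, hg, rfl⟩
  simp only [SetLike.mem_coe, AddMonoidHom.mem_ker, tensorSum, Finsupp.liftAddHom_apply]
  rw [Finsupp.sum_mapRange_index fun m => map_zero (RTensor.mkHom M m)]
  simp only [RTensor.mkHom_apply, ← RTensor.smul_tmul]
  have : g.sum (fun m r => RTensor.tmul (R := R) M (MulOpposite.op r • m) a) =
      (RTensor.mkHom (R := R) M).flip a (g.sum fun m r => MulOpposite.op r • m) := by
    rw [Finsupp.sum, Finsupp.sum, map_sum]; rfl
  rw [this, hg, map_zero]

theorem tensorSum_surjective : Function.Surjective (tensorSum R M A) := by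
  intro x
  induction x using RTensor.induction with
  | zero => exact ⟨0, map_zero _⟩
  | tmul m a => exact ⟨_, tensorSum_single m a⟩
  | add x y hx hy =>
    obtain ⟨x, rfl⟩ := hx
    obtain ⟨y, rfl⟩ := hy
    exact ⟨x + y, map_add _ _ _⟩

/-- Formal sums of pure tensors which vanish in `M ⊗_R A` are relations. -/
theorem mem_tensorRelations_of_tensorSum_eq_zero {x : M →₀ A} (hx : tensorSum R M A x = 0) :
    x ∈ tensorRelations R M A := by
  classical
  let Q := (M →₀ A) ⧸ tensorRelations R M A
  let φ : M →+ A →+ Q := AddMonoidHom.mk' (fun m => (QuotientAddGroup.mk' _).comp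
      (Finsupp.singleAddHom m)) (fun m m' => by
    ext a
    rw [AddMonoidHom.add_apply]
    -- Additivity in `m` is itself a relation: the formal combination `-(m + m') + m + m'` evaluates
    -- to `0` in `M`. Balancedness below comes in the same way from `-(m r) + r·m`.
    refine QuotientAddGroup.eq.2 (AddSubgroup.subset_closure
      ⟨- Finsupp.single (m + m') 1 + (Finsupp.single m 1 + Finsupp.single m' 1), a, ?_, ?_⟩)
    · rw [Finsupp.sum_add_index', Finsupp.sum_add_index', Finsupp.sum_neg_index]
      all_goals simp [add_smul]
    · rw [Finsupp.mapRange_add (by simp [add_smul]), Finsupp.mapRange_add (by simp [add_smul]),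
        Finsupp.mapRange_neg (by simp)]
      simp)
  have hφ (m : M) (r : R) (a : A) : φ (MulOpposite.op r • m) a = φ m (r • a) := by
    refine QuotientAddGroup.eq.2 (AddSubgroup.subset_closure
      ⟨- Finsupp.single (MulOpposite.op r • m) 1 + Finsupp.single m r, a, ?_, ?_⟩)
    · rw [Finsupp.sum_add_index', Finsupp.sum_neg_index]
      all_goals simp [add_smul]
    · rw [Finsupp.mapRange_add (by simp [add_smul]), Finsupp.mapRange_neg (by simp)]
      simp
  have h : (RTensor.lift φ hφ).comp (tensorSum R M A) = QuotientAddGroup.mk' _ := by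
    ext m a
    simp only [AddMonoidHom.comp_apply, Finsupp.singleAddHom_apply, tensorSum_single,
      RTensor.lift_tmul]
    rfl
  have := DFunLike.congr_fun h x
  rw [AddMonoidHom.comp_apply, hx, map_zero] at this
  exact (QuotientAddGroup.eq_zero_iff _).1 this.symm

/-- Vanishing in `M ⊗ B` is witnessed by finitely many relations with elements `b k`. Their
coefficients form a finite system with constants in `A`, and a solution in `A` gives the same
relations over `A`. -/
theorem SolvesSystems.tensor_injective {f : A →ₗ[R] B} (hf : SolvesSystems f) :
    Function.Injective (RTensor.map M f) := by
  classical
  rw [injective_iff_map_eq_zero]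
  intro x hx
  obtain ⟨a, rfl⟩ := tensorSum_surjective x
  refine tensorSum_eq_zero ?_
  have h : ∀ a, RTensor.map M f (tensorSum R M A a) =
      tensorSum R M B (Finsupp.mapRange.addMonoidHom f.toAddMonoidHom a) := by
    intro a
    induction a using Finsupp.induction_linear with
    | zero => simp
    | add x y hx hy => simp only [map_add, hx, hy]
    | single m a =>
      rw [tensorSum_single, RTensor.map_tmul, Finsupp.mapRange.addMonoidHom_apply,
        Finsupp.mapRange_single, tensorSum_single]
      rfl
  rw [h] at hx
  obtain ⟨κ, _, g, b, hg, hb⟩ := mem_tensorRelations (mem_tensorRelations_of_tensorSum_eq_zero hx)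
  -- Outside `s` the equations read `0 = 0`, so finitely many equations remain.
  let s : Finset M := a.support ∪ Finset.univ.biUnion fun k => (g k).support
  let e := s.equivFin
  have hb' (m : M) : f (a m) = ∑ k, g k m • b k := by
    simpa [Finsupp.finsetSum_apply] using DFunLike.congr_fun hb m
  obtain ⟨c, hc⟩ := hf (Fin s.card) κ (fun i k => g k (e.symm i)) (fun i => a (e.symm i)) b
    fun i => (hb' _).symm
  have : a = ∑ k, (g k).mapRange (fun r => r • c k) (zero_smul R (c k)) := by
    ext m
    by_cases hm : m ∈ s
    · have := hc (e ⟨m, hm⟩)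
      simp only [Equiv.symm_apply_apply] at this
      simpa [Finsupp.finsetSum_apply] using this.symm
    · simp only [s, Finset.mem_union, Finset.mem_biUnion, Finset.mem_univ, true_and, not_or,
        not_exists, Finsupp.notMem_support_iff] at hm
      simp [Finsupp.finsetSum_apply, hm]
  rw [this]
  exact AddSubgroup.sum_mem _ fun k _ => AddSubgroup.subset_closure ⟨g k, c k, hg k, rfl⟩

theorem SolvesSystems.isPureShortExact {f : A →ₗ[R] B} {g : B →ₗ[R] C} (h : SolvesSystems f)
    (hfg : Function.Exact f g) (hg : Function.Surjective g) : IsPureShortExact f g where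
  injective := h.injective
  exact := hfg
  surjective := hg
  tensor_injective _ _ _ := h.tensor_injective
  tensor_exact _ _ _ := RTensor.map_exact hfg hg
  tensor_surjective _ _ _ := RTensor.map_surjective hg

end Tensor

/-! ### From pure exact sequences to systems -/

section

variable {R : Type u} [Ring R] {A B C : Type u} [AddCommGroup A] [Module R A]
  [AddCommGroup B] [Module R B] [AddCommGroup C] [Module R C]

/-- The test module `M` is the right module presented by the transposed system. The tensor `∑ m i ⊗
a i` dies in `M ⊗ B`, hence in `M ⊗ A`; the map `w ⊗ a ↦ (w i • a)` from `M ⊗ A` to `A^ι` modulo the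
image `T` of the system sends it to the class of `a`. -/
theorem IsPureShortExact.solvesSystems {f : A →ₗ[R] B} {g : B →ₗ[R] C}
    (h : IsPureShortExact f g) : SolvesSystems f := by
  classical
  intro ι κ _ _ r a b hb
  let N : Submodule Rᵐᵒᵖ (ι → R) := Submodule.span Rᵐᵒᵖ (Set.range fun j i => r i j)
  let M := (ι → R) ⧸ N
  let m (i : ι) : M := N.mkQ (Pi.single i 1)
  have hm (j : κ) : ∑ i, MulOpposite.op (r i j) • m i = 0 := by
    simp only [m, ← map_smul, ← map_sum]
    have : ∑ i, MulOpposite.op (r i j) • (Pi.single i 1 : ι → R) = fun i => r i j := by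
      ext i
      simp [Finset.sum_apply, Pi.single_apply]
    rw [this]
    exact (Submodule.Quotient.mk_eq_zero _).2 (Submodule.subset_span ⟨j, rfl⟩)
  let x : RTensor (R := R) M A := ∑ i, RTensor.tmul M (m i) (a i)
  have hx : x = 0 := by
    refine h.tensor_injective M ?_
    simp only [x, map_sum, map_zero, RTensor.map_tmul, ← hb]
    simp only [← RTensor.mkHom_apply, map_sum]
    rw [Finset.sum_comm]
    refine Finset.sum_eq_zero fun j _ => ?_
    simp only [RTensor.mkHom_apply, ← RTensor.smul_tmul]
    simp only [← RTensor.mkHom_apply, ← AddMonoidHom.finsetSum_apply, ← map_sum, hm, map_zero]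
    rfl
  let T : (κ → A) →+ (ι → A) :=
    AddMonoidHom.mk' (fun y i => ∑ j, r i j • y j) fun y z => by
      ext i; simp [smul_add, Finset.sum_add_distrib]
  let φ₀ : (ι → R) →+ A →+ (ι → A) ⧸ T.range := AddMonoidHom.mk' (fun w =>
    (QuotientAddGroup.mk' T.range).comp (AddMonoidHom.mk' (fun a i => w i • a)
      fun a b => by ext i; simp)) fun w w' => by
        ext a
        simp only [AddMonoidHom.comp_apply, AddMonoidHom.add_apply, ← map_add]
        congr 1
        ext i
        simp [add_smul]
  have hφ₀ : ∀ (w : ι → R) (s : R) (a : A), φ₀ (MulOpposite.op s • w) a = φ₀ w (s • a) := by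
    intro w s a
    simp [φ₀, mul_smul]
  have hN : N.toAddSubgroup ≤ φ₀.ker := by
    intro w hw
    rw [AddMonoidHom.mem_ker]
    replace hw : w ∈ N := hw
    induction hw using Submodule.span_induction with
    | mem w hw =>
      obtain ⟨j, rfl⟩ := hw
      ext a
      refine (QuotientAddGroup.eq_zero_iff _).2 ⟨Pi.single j a, ?_⟩
      ext i
      simp [T, Pi.single_apply]
    | zero => simp
    | add w w' _ _ hw hw' => rw [map_add, hw, hw', add_zero]
    | smul s w _ hw =>
      ext a
      rw [← MulOpposite.op_unop s, hφ₀, hw]; rfl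
  let φ : M →+ A →+ (ι → A) ⧸ T.range := QuotientAddGroup.lift N.toAddSubgroup φ₀ hN
  have hφ : ∀ (m : M) (s : R) (a : A), φ (MulOpposite.op s • m) a = φ m (s • a) := by
    intro m s a
    obtain ⟨w, rfl⟩ := N.mkQ_surjective m
    exact hφ₀ w s a
  have key : RTensor.lift φ hφ x = QuotientAddGroup.mk' T.range a := by
    simp only [x, map_sum, RTensor.lift_tmul]
    have : ∀ i, φ (m i) (a i) = QuotientAddGroup.mk' T.range (Pi.single i (a i)) := by
      intro i
      change QuotientAddGroup.mk' T.range _ = _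
      congr 1
      ext i'
      by_cases h : i' = i
      · subst h; simp
      · simp [h]
    simp only [this, ← map_sum, Finset.univ_sum_single]
  rw [hx, map_zero] at key
  obtain ⟨y, hy⟩ := (QuotientAddGroup.eq_zero_iff _).1 key.symm
  exact ⟨y, fun i => congrFun hy i⟩

theorem IsPureShortExact.liftsSystems {f : A →ₗ[R] B} {g : B →ₗ[R] C}
    (h : IsPureShortExact f g) : LiftsSystems g :=
  h.solvesSystems.liftsSystems h.exact h.surjective

end

/-! ### Lifting and extension properties -/

section Lifting

variable {R : Type v} [Ring R] {A B C : Type u} [AddCommGroup A] [Module R A]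
  [AddCommGroup B] [Module R B] [AddCommGroup C] [Module R C]

theorem IsPureProjective.exists_lift {P : ModuleCat.{u} R} (hP : IsPureProjective P)
    {g : B →ₗ[R] C} (hg : Function.Surjective g) (hg' : LiftsSystems g) (h : P →ₗ[R] C) :
    ∃ k : P →ₗ[R] B, g ∘ₗ k = h := by
  have hex : Function.Exact (LinearMap.ker g).subtype g := LinearMap.exact_subtype_ker_map g
  exact hP (ModuleCat.of R (LinearMap.ker g)) (ModuleCat.of R B) (ModuleCat.of R C) _ g
    ((hg'.solvesSystems (Submodule.subtype_injective _) hex).isPureShortExact hex hg) h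

theorem IsPureInjective.exists_extension {E : ModuleCat.{u} R} (hE : IsPureInjective E)
    {f : A →ₗ[R] B} (hf : SolvesSystems f) (h : A →ₗ[R] E) :
    ∃ k : B →ₗ[R] E, k ∘ₗ f = h :=
  hE (ModuleCat.of R A) (ModuleCat.of R B) (ModuleCat.of R (B ⧸ LinearMap.range f)) f
    (LinearMap.range f).mkQ (hf.isPureShortExact (LinearMap.exact_map_mkQ_range f)
      (Submodule.mkQ_surjective _)) h

theorem IsPureProjective.of_retract {P Q : ModuleCat.{u} R} (hP : IsPureProjective P)
    (i : Q →ₗ[R] P) (p : P →ₗ[R] Q) (hip : p ∘ₗ i = LinearMap.id) : IsPureProjective Q := by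
  intro A B C f g hfg h
  obtain ⟨k, hk⟩ := hP A B C f g hfg (h ∘ₗ p)
  refine ⟨k ∘ₗ i, ?_⟩
  rw [← LinearMap.comp_assoc, hk, LinearMap.comp_assoc, hip, LinearMap.comp_id]

theorem IsPureInjective.of_retract {P Q : ModuleCat.{u} R} (hP : IsPureInjective P)
    (i : Q →ₗ[R] P) (p : P →ₗ[R] Q) (hip : p ∘ₗ i = LinearMap.id) : IsPureInjective Q := by
  intro A B C f g hfg h
  obtain ⟨k, hk⟩ := hP A B C f g hfg (i ∘ₗ h)
  refine ⟨p ∘ₗ k, ?_⟩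
  rw [LinearMap.comp_assoc, hk, ← LinearMap.comp_assoc, hip, LinearMap.id_comp]

theorem isPureProjective_of_subsingleton (P : ModuleCat.{u} R) [Subsingleton P] :
    IsPureProjective P :=
  fun _ _ _ _ _ _ _ => ⟨0, LinearMap.ext fun x => by simp [Subsingleton.elim x 0]⟩

theorem isPureInjective_of_subsingleton (P : ModuleCat.{u} R) [Subsingleton P] :
    IsPureInjective P :=
  fun _ _ _ _ _ _ _ => ⟨0, LinearMap.ext fun _ => Subsingleton.elim _ _⟩

theorem isPureProjective_directSum {ι : Type u} (P : ι → ModuleCat.{u} R)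
    (hP : ∀ i, IsPureProjective (P i)) :
    IsPureProjective (ModuleCat.of R (DirectSum ι fun i => P i)) := by
  classical
  intro A B C f g hfg h
  choose k hk using fun i => hP i A B C f g hfg (h ∘ₗ DirectSum.lof R ι (fun i => P i) i)
  refine ⟨DirectSum.toModule R ι B k, DirectSum.linearMap_ext _ fun i => ?_⟩
  rw [← hk i]
  ext x
  simp

end Lifting

/-! ### Enough pure projectives -/

section SystemModule

variable {R : Type u} [Ring R]

/-- The finitely presented module given by finitely many generators and relations. -/
def systemModule {ι κ : Type} (r : ι → κ → R) : ModuleCat.{u} R :=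
  ModuleCat.of R ((κ → R) ⧸ Submodule.span R (Set.range r))

/-- The generators of `systemModule r`. -/
def systemModule.gen {ι κ : Type} [DecidableEq κ] (r : ι → κ → R) (j : κ) : systemModule r :=
  Submodule.Quotient.mk (Pi.single j 1)

variable {ι κ : Type} [Fintype κ] [DecidableEq κ] (r : ι → κ → R)

theorem systemModule.relation (i : ι) : ∑ j, r i j • systemModule.gen r j = 0 := by
  have : ∑ j, r i j • systemModule.gen r j =
      (Submodule.span R (Set.range r)).mkQ (∑ j, r i j • (Pi.single j 1 : κ → R)) := by
    simp only [map_sum, map_smul]; rfl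
  rw [this, ← pi_eq_sum_univ']
  exact (Submodule.Quotient.mk_eq_zero _).2 (Submodule.subset_span ⟨i, rfl⟩)

theorem systemModule.exists_lift {C : Type*} [AddCommGroup C] [Module R C] (c : κ → C)
    (hc : ∀ i, ∑ j, r i j • c j = 0) :
    ∃ f : systemModule r →ₗ[R] C, ∀ j, f (systemModule.gen r j) = c j := by
  refine ⟨Submodule.liftQ _ (Fintype.linearCombination R c) ?_, fun j => ?_⟩
  · rw [Submodule.span_le]
    rintro _ ⟨i, rfl⟩
    simpa [Fintype.linearCombination_apply] using hc i
  · change Fintype.linearCombination R c (Pi.single j 1) = c j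
    simp [Fintype.linearCombination_apply_single]

variable {r} in
theorem systemModule.hom_ext {C : Type*} [AddCommGroup C] [Module R C]
    {f g : systemModule r →ₗ[R] C}
    (h : ∀ j, f (systemModule.gen r j) = g (systemModule.gen r j)) : f = g := by
  refine Submodule.linearMap_qext _ (LinearMap.pi_ext' fun j => LinearMap.ext_ring ?_)
  exact h j

/-- Maps out of this module are the solutions of the system `r`, so lifting a map is lifting a
solution. -/
theorem isPureProjective_systemModule [Fintype ι] : IsPureProjective (systemModule r) := by
  intro A B C f g hfg h
  obtain ⟨b, hb, hr⟩ := hfg.liftsSystems ι κ r (fun j => h (systemModule.gen r j)) fun i => by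
    simp_rw [← map_smul, ← map_sum, systemModule.relation, map_zero]
  obtain ⟨k, hk⟩ := systemModule.exists_lift r b hr
  exact ⟨k, systemModule.hom_ext fun j => by simp [hk, hb]⟩

variable {B C : Type u} [AddCommGroup B] [Module R B] [AddCommGroup C] [Module R C]


/-- A finite homogeneous system of linear equations together with a solution in `C`. -/
structure SystemSolution (R : Type u) [Ring R] (C : Type u) [AddCommGroup C] [Module R C] :
    Type u where
  /-- the number of equations -/
  k : ℕ
  /-- the number of unknowns -/
  l : ℕ
  /-- the coefficients -/
  coeff : Fin k → Fin l → R
  /-- the solution -/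
  sol : Fin l → C
  isSolution : ∀ i, ∑ j, coeff i j • sol j = 0

/-- Indexing by `Fin` keeps `SystemSolution` in `Type u`, so that the direct sum over all solutions
is a module of the right universe. Arbitrary finite index types are transported here. -/
theorem SystemSolution.exists_index (ι κ : Type) [Fintype ι] [Fintype κ] (r : ι → κ → R)
    (c : κ → C) (hc : ∀ i, ∑ j, r i j • c j = 0) :
    ∃ (s : SystemSolution R C) (e : κ → Fin s.l), (∀ j, s.sol (e j) = c j) ∧
      ∀ i, ∑ j, r i j • systemModule.gen s.coeff (e j) = 0 := by
  let e := Fintype.equivFin ι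
  let e' := Fintype.equivFin κ
  refine ⟨⟨_, _, fun i j => r (e.symm i) (e'.symm j), fun j => c (e'.symm j), fun i => ?_⟩,
    e', fun j => ?_, fun i => ?_⟩
  · rw [Equiv.sum_comp e'.symm fun j => r (e.symm i) j • c j, hc]
  · simp
  · have := systemModule.relation (fun i j => r (e.symm i) (e'.symm j)) (e i)
    rw [← Equiv.sum_comp e'] at this
    simpa only [Equiv.symm_apply_apply] using this

variable (C) in
/-- Every module is a pure quotient of a pure projective one. -/
theorem exists_pureProjective_cover : ∃ (P : ModuleCat.{u} R) (g : P →ₗ[R] C),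
    IsPureProjective P ∧ Function.Surjective g ∧ LiftsSystems g := by
  classical
  choose φ hφ using fun s : SystemSolution R C =>
    systemModule.exists_lift s.coeff s.sol s.isSolution
  let M (s : SystemSolution R C) : ModuleCat.{u} R := systemModule s.coeff
  let g : (DirectSum _ fun s => M s) →ₗ[R] C := DirectSum.toModule R (SystemSolution R C) C φ
  have hg : LiftsSystems g := by
    intro ι κ _ _ r c hc
    obtain ⟨s, e, he, hs⟩ := SystemSolution.exists_index ι κ r c hc
    let ψ := DirectSum.lof R _ (fun s => M s) s
    have hψ (x) : g (ψ x) = φ s x := by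
      simp only [g, ψ, DirectSum.toModule_lof]
    refine ⟨fun j => ψ (systemModule.gen _ (e j)), fun j => ?_, fun i => ?_⟩
    · rw [hψ, hφ, he]
    · simp_rw [← map_smul, ← map_sum, hs, map_zero]
  refine ⟨_, g, isPureProjective_directSum _ fun s => isPureProjective_systemModule _,
    fun c => ?_, hg⟩
  -- Surjectivity is the case of no equations in one unknown.
  obtain ⟨b, hb, -⟩ := hg Empty Unit (fun e => e.elim) (fun _ => c) (fun e => e.elim)
  exact ⟨b (), hb ()⟩

end SystemModule

/-! ### Enough pure injectives, by character modules -/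

section Characters

variable (R : Type v) [Ring R]

/-- The character group of a right module, as a left module. -/
def RightChar (E : Type u) [AddCommGroup E] : Type u := E →+ AddCircle (1 : ℚ)

/-- The character group of a left module, as a right module. -/
def LeftChar (A : Type u) [AddCommGroup A] : Type u := A →+ AddCircle (1 : ℚ)

instance (E : Type u) [AddCommGroup E] : AddCommGroup (RightChar E) :=
  inferInstanceAs (AddCommGroup (E →+ AddCircle (1 : ℚ)))

instance (A : Type u) [AddCommGroup A] : AddCommGroup (LeftChar A) :=
  inferInstanceAs (AddCommGroup (A →+ AddCircle (1 : ℚ)))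

instance (E : Type u) [AddCommGroup E] : FunLike (RightChar E) E (AddCircle (1 : ℚ)) :=
  inferInstanceAs (FunLike (E →+ AddCircle (1 : ℚ)) _ _)

instance (E : Type u) [AddCommGroup E] :
    AddMonoidHomClass (RightChar E) E (AddCircle (1 : ℚ)) :=
  inferInstanceAs (AddMonoidHomClass (E →+ AddCircle (1 : ℚ)) _ _)

instance (A : Type u) [AddCommGroup A] : FunLike (LeftChar A) A (AddCircle (1 : ℚ)) :=
  inferInstanceAs (FunLike (A →+ AddCircle (1 : ℚ)) _ _)

instance (A : Type u) [AddCommGroup A] :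
    AddMonoidHomClass (LeftChar A) A (AddCircle (1 : ℚ)) :=
  inferInstanceAs (AddMonoidHomClass (A →+ AddCircle (1 : ℚ)) _ _)

variable {R}

theorem RightChar.add_apply {E : Type u} [AddCommGroup E] (x y : RightChar E) (e : E) :
    (x + y) e = x e + y e := rfl

instance (E : Type u) [AddCommGroup E] [Module Rᵐᵒᵖ E] : Module R (RightChar E) where
  smul r x := (x : E →+ AddCircle (1 : ℚ)).comp (DistribSMul.toAddMonoidHom E (MulOpposite.op r))
  one_smul x := DFunLike.ext _ _ fun e => congrArg x (one_smul _ e)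
  mul_smul _ _ x := DFunLike.ext _ _ fun e => congrArg x (mul_smul _ _ e)
  smul_zero _ := DFunLike.ext _ _ fun _ => rfl
  smul_add _ _ _ := DFunLike.ext _ _ fun _ => rfl
  add_smul _ _ x := DFunLike.ext _ _ fun e =>
    (congrArg x (add_smul _ _ e)).trans (map_add x _ _)
  zero_smul x := DFunLike.ext _ _ fun e => (congrArg x (zero_smul _ e)).trans (map_zero x)

instance (A : Type u) [AddCommGroup A] [Module R A] : Module Rᵐᵒᵖ (LeftChar A) where
  smul r x := (x : A →+ AddCircle (1 : ℚ)).comp (DistribSMul.toAddMonoidHom A r.unop)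
  one_smul x := DFunLike.ext _ _ fun e => congrArg x (one_smul _ e)
  mul_smul _ _ x := DFunLike.ext _ _ fun e => congrArg x (mul_smul _ _ e)
  smul_zero _ := DFunLike.ext _ _ fun _ => rfl
  smul_add _ _ _ := DFunLike.ext _ _ fun _ => rfl
  add_smul _ _ x := DFunLike.ext _ _ fun e =>
    (congrArg x (add_smul _ _ e)).trans (map_add x _ _)
  zero_smul x := DFunLike.ext _ _ fun e => (congrArg x (zero_smul _ e)).trans (map_zero x)

/-- By adjunction, maps from `A` to the character module of `E` are characters of `E ⊗ A`. Purity
makes `E ⊗ A → E ⊗ B` injective, and characters extend because `ℚ/ℤ` is divisible. -/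
theorem isPureInjective_rightChar (E : Type u) [AddCommGroup E] [Module Rᵐᵒᵖ E] :
    IsPureInjective (ModuleCat.of R (RightChar E)) := by
  intro A B C f g hfg h
  let φ : E →+ A →+ AddCircle (1 : ℚ) := AddMonoidHom.mk' (fun e =>
    AddMonoidHom.mk' (fun a => (h a : RightChar E) e)
      fun a b => by rw [map_add]; exact RightChar.add_apply _ _ _)
    fun e e' => by ext a; exact map_add (h a : RightChar E) e e'
  have hφ : ∀ (e : E) (r : R) (a : A), φ (MulOpposite.op r • e) a = φ e (r • a) := by
    intro e r a
    simp only [φ, AddMonoidHom.mk'_apply, map_smul]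
    rfl
  obtain ⟨τ, hτ⟩ := (Module.Baer.of_divisible _).extension_property_addMonoidHom
    (RTensor.map E f) (hfg.tensor_injective E) (RTensor.lift φ hφ)
  let k : B →ₗ[R] RightChar E :=
    { toFun := fun b => (τ.comp ((RTensor.mkHom (R := R) E).flip b) : E →+ AddCircle (1 : ℚ))
      map_add' := fun b b' => DFunLike.ext _ _ fun e => by
        change τ _ = τ _ + τ _
        simp
      map_smul' := fun r b => DFunLike.ext _ _ fun e => by
        change τ (RTensor.tmul E e (r • b)) = τ (RTensor.tmul E (MulOpposite.op r • e) b)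
        rw [RTensor.smul_tmul] }
  refine ⟨k, LinearMap.ext fun a => DFunLike.ext (F := RightChar E) _ _ fun e => ?_⟩
  exact DFunLike.congr_fun hτ (RTensor.tmul E e a)

/-- Evaluation, as a map from a module to its double character module. -/
def charEval (A : Type u) [AddCommGroup A] [Module R A] : A →ₗ[R] RightChar (LeftChar A) where
  toFun a := (AddMonoidHom.mk' (fun x : LeftChar A => x a) fun _ _ => rfl :
    LeftChar A →+ AddCircle (1 : ℚ))
  map_add' a b := DFunLike.ext _ _ fun x => map_add x a b
  map_smul' _ _ := rfl

theorem charEval_apply (A : Type u) [AddCommGroup A] [Module R A] (a : A) (x : LeftChar A) :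
    charEval (R := R) A a x = x a := rfl

/-- It suffices that every character `χ` of `A^ι` modulo the image of the system kills `a`. The
components `x i` of `χ` solve the transposed homogeneous system; pairing it with the solution `ξ` in
the double dual gives `χ a = 0`. -/
theorem solvesSystems_charEval (A : Type u) [AddCommGroup A] [Module R A] :
    SolvesSystems (charEval (R := R) A) := by
  classical
  intro ι κ _ _ r a ξ hξ
  let T : (κ → A) →+ (ι → A) :=
    AddMonoidHom.mk' (fun y i => ∑ j, r i j • y j) fun y z => by
      ext i; simp [smul_add, Finset.sum_add_distrib]
  suffices a ∈ T.range by
    obtain ⟨y, hy⟩ := this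
    exact ⟨y, fun i => congrFun hy i⟩
  rw [← QuotientAddGroup.eq_zero_iff (N := T.range)]
  refine CharacterModule.eq_zero_of_character_apply fun χ => ?_
  let χ' : (ι → A) →+ AddCircle (1 : ℚ) :=
    AddMonoidHom.comp (χ : _ →+ AddCircle (1 : ℚ)) (QuotientAddGroup.mk' T.range)
  let x (i : ι) : LeftChar A := χ'.comp (AddMonoidHom.single (fun _ => A) i)
  have hχ (w : ι → A) : χ' w = ∑ i, x i (w i) := by
    conv_lhs => rw [← Finset.univ_sum_single w, map_sum]
    rfl
  have hx (j : κ) : ∑ i, MulOpposite.op (r i j) • x i = 0 := by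
    refine DFunLike.ext (F := LeftChar A) _ _ fun y => ?_
    have h1 : (∑ i, MulOpposite.op (r i j) • x i : LeftChar A) y = ∑ i, x i (r i j • y) :=
      (map_sum (AddMonoidHom.eval y : (A →+ AddCircle (1 : ℚ)) →+ AddCircle (1 : ℚ)) _ _)
    have h2 : χ' (T (Pi.single j y)) = 0 := by
      have : QuotientAddGroup.mk' T.range (T (Pi.single j y)) = 0 :=
        (QuotientAddGroup.eq_zero_iff _).2 ⟨_, rfl⟩
      change χ (QuotientAddGroup.mk' T.range (T (Pi.single j y))) = 0
      rw [this, map_zero]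
    refine h1.trans (Eq.trans ?_ h2)
    simp [hχ, T, Pi.single_apply]
  change χ' a = 0
  have h3 (i : ι) : x i (a i) = ∑ j, ξ j (MulOpposite.op (r i j) • x i) := by
    rw [← charEval_apply (R := R), ← hξ]
    exact (map_sum (AddMonoidHom.eval (x i) : (LeftChar A →+ AddCircle (1 : ℚ)) →+
      AddCircle (1 : ℚ)) _ _)
  rw [hχ]
  simp_rw [h3]
  rw [Finset.sum_comm]
  refine Finset.sum_eq_zero fun j _ => ?_
  rw [← map_sum, hx, map_zero]

/-- Every module is a pure submodule of a pure injective one. -/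
theorem exists_pureInjective_embedding (A : Type u) [AddCommGroup A] [Module R A] :
    ∃ (E : ModuleCat.{u} R) (f : A →ₗ[R] E), IsPureInjective E ∧ SolvesSystems f :=
  ⟨_, _, isPureInjective_rightChar (LeftChar A), solvesSystems_charEval A⟩

/-- A pure embedding of `A` in a pure injective factors through `f`, and the first factor of a pure
embedding is pure. -/
theorem solvesSystems_of_forall_isPureInjective {A B : Type u} [AddCommGroup A] [Module R A]
    [AddCommGroup B] [Module R B] {f : A →ₗ[R] B}
    (hf : ∀ (E : ModuleCat.{u} R), IsPureInjective E → ∀ h : A →ₗ[R] E,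
      ∃ k : B →ₗ[R] E, k ∘ₗ f = h) : SolvesSystems f := by
  obtain ⟨E, h, hE, hh⟩ := exists_pureInjective_embedding (R := R) A
  obtain ⟨k, rfl⟩ := hf E hE h
  exact hh.of_comp

end Characters

/-! ### Pure exactness at a spot, in terms of systems -/

section Pairs

variable {R : Type v} [Ring R] {A B C D F : Type u} [AddCommGroup A] [Module R A]
  [AddCommGroup B] [Module R B] [AddCommGroup C] [Module R C] [AddCommGroup D] [Module R D]
  [AddCommGroup F] [Module R F]

theorem isPureEpi_of_liftsSystems {g : B →ₗ[R] C} (hg : Function.Surjective g)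
    (h : LiftsSystems g) : IsPureEpi g :=
  (h.solvesSystems (Submodule.subtype_injective _)
    (LinearMap.exact_subtype_ker_map g)).isPureShortExact (LinearMap.exact_subtype_ker_map g) hg

theorem isPureMono_of_solvesSystems {f : A →ₗ[R] B} (h : SolvesSystems f) : IsPureMono f :=
  h.isPureShortExact (LinearMap.exact_map_mkQ_range f) (Submodule.mkQ_surjective _)

/-- Finite homogeneous systems of linear equations have the same solutions among cycles as among
boundaries with solvable bounding data. -/
def ExactOnSystems (d : A →ₗ[R] B) (e : B →ₗ[R] C) : Prop :=
  ∀ (ι κ : Type) [Fintype ι] [Fintype κ] (r : ι → κ → R) (c : κ → B),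
    (∀ j, e (c j) = 0) → (∀ i, ∑ j, r i j • c j = 0) →
      ∃ b : κ → A, (∀ j, d (b j) = c j) ∧ ∀ i, ∑ j, r i j • b j = 0

/-- The map `Coker d → C` induced by `e` solves systems of linear equations. -/
def CoexactOnSystems (d : A →ₗ[R] B) (e : B →ₗ[R] C) : Prop :=
  ∀ (ι κ : Type) [Fintype ι] [Fintype κ] (r : ι → κ → R) (a : ι → B) (b : κ → C),
    (∀ i, ∑ j, r i j • b j = e (a i)) →
      ∃ x : κ → B, ∀ i, ∑ j, r i j • x j - a i ∈ LinearMap.range d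

theorem ExactOnSystems.exists_eq {d : A →ₗ[R] B} {e : B →ₗ[R] C} (h : ExactOnSystems d e) {b : B}
    (hb : e b = 0) : ∃ a, d a = b := by
  obtain ⟨a, ha, -⟩ := h Empty Unit (fun e => e.elim) (fun _ => b) (fun _ => hb) fun e => e.elim
  exact ⟨a (), ha ()⟩

theorem CoexactOnSystems.exists_eq {d : A →ₗ[R] B} {e : B →ₗ[R] C} (h : CoexactOnSystems d e)
    {b : B} (hb : e b = 0) : ∃ a, d a = b := by
  obtain ⟨x, hx⟩ := h Unit Empty (fun _ e => e.elim) (fun _ => -b) (fun e => e.elim) (by simp [hb])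
  simpa using hx ()

/-- Write `c = d₂ b'` by exactness at `D`; the defects `∑ r b'` are `d₂`-cycles, hence equal `d₁ a`.
Purity at `B` solves `∑ r x = a` modulo the image of `d₀`, and `b' - d₁ x` is the wanted solution.
-/
theorem exactOnSystems_of_coexactOnSystems {d₀ : A →ₗ[R] B} {d₁ : B →ₗ[R] C} {d₂ : C →ₗ[R] D}
    {d₃ : D →ₗ[R] F} (h₁₀ : d₁ ∘ₗ d₀ = 0) (h₂₁ : d₂ ∘ₗ d₁ = 0) (h₁ : CoexactOnSystems d₀ d₁)
    (h₂ : CoexactOnSystems d₁ d₂) (h₃ : CoexactOnSystems d₂ d₃) : ExactOnSystems d₂ d₃ := by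
  intro ι κ _ _ r c hc hr
  choose b' hb' using fun j => h₃.exists_eq (hc j)
  choose a ha using fun i => h₂.exists_eq (b := ∑ j, r i j • b' j) (by simp [hb', hr])
  obtain ⟨x, hx⟩ := h₁ ι κ r a b' fun i => (ha i).symm
  refine ⟨fun j => b' j - d₁ (x j), fun j => ?_, fun i => ?_⟩
  · simp [hb', ← LinearMap.comp_apply, h₂₁]
  · obtain ⟨y, hy⟩ := hx i
    have := congrArg d₁ hy
    rw [← LinearMap.comp_apply, h₁₀, LinearMap.zero_apply, map_sub, ha] at this
    simp only [map_sum, map_smul] at this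
    simp only [smul_sub, Finset.sum_sub_distrib]
    rw [← neg_sub, ← this, neg_zero]

section

variable {d₀ : A →ₗ[R] B} {d₁ : B →ₗ[R] C} {d₂ : C →ₗ[R] D} {d₃ : D →ₗ[R] F}
  (h₁₀ : d₁ ∘ₗ d₀ = 0) (h₂₁ : d₂ ∘ₗ d₁ = 0) (h₃₂ : d₃ ∘ₗ d₂ = 0)

include h₁₀ in
theorem ExactOnSystems.liftsSystems_codRestrict (h₁ : ExactOnSystems d₀ d₁) :
    LiftsSystems (d₀.codRestrict (LinearMap.ker d₁) fun x => LinearMap.congr_fun h₁₀ x) := by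
  intro ι κ _ _ r c hc
  obtain ⟨b, hb, hr⟩ := h₁ ι κ r (fun j => c j) (fun j => (c j).2) fun i => by
    simpa using congrArg (Submodule.subtype _) (hc i)
  exact ⟨b, fun j => Subtype.ext (hb j), hr⟩

include h₁₀ in
theorem ExactOnSystems.surjective_codRestrict (h₁ : ExactOnSystems d₀ d₁) :
    Function.Surjective
      (d₀.codRestrict (LinearMap.ker d₁) fun x => LinearMap.congr_fun h₁₀ x) := by
  rintro ⟨b, hb⟩
  obtain ⟨a, ha⟩ := h₁.exists_eq hb
  exact ⟨a, Subtype.ext ha⟩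

-- In `Ker d₁ → B → Ker d₂` the right-hand map lifts systems, so the left-hand one is pure.
include h₂₁ in
theorem ExactOnSystems.solvesSystems_subtype (h₂ : ExactOnSystems d₁ d₂) :
    SolvesSystems (LinearMap.ker d₁).subtype := by
  refine (h₂.liftsSystems_codRestrict h₂₁).solvesSystems (Submodule.subtype_injective _) ?_
  exact fun x => ⟨fun h => ⟨⟨x, congrArg Subtype.val h⟩, rfl⟩, by
    rintro ⟨y, rfl⟩
    exact Subtype.ext y.2⟩

include h₁₀ h₂₁ in
theorem isPureAdmissible_of_exactOnSystems (h₁ : ExactOnSystems d₀ d₁)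
    (h₂ : ExactOnSystems d₁ d₂) : IsPureAdmissible d₀ :=
  ⟨ModuleCat.of R (LinearMap.ker d₁), _, _,
    isPureEpi_of_liftsSystems (h₁.surjective_codRestrict h₁₀) (h₁.liftsSystems_codRestrict h₁₀),
    isPureMono_of_solvesSystems (h₂.solvesSystems_subtype h₂₁), rfl⟩

-- The differentials factor through `Ker d₁` and `Ker d₂`. Purity of each inclusion comes from
-- exactness at the next spot, hence three consecutive spots.
include h₁₀ h₂₁ h₃₂ in
theorem isPureExactPair_of_exactOnSystems (h₁ : ExactOnSystems d₀ d₁)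
    (h₂ : ExactOnSystems d₁ d₂) (h₃ : ExactOnSystems d₂ d₃) : IsPureExactPair d₀ d₁ where
  admissible_left := isPureAdmissible_of_exactOnSystems h₁₀ h₂₁ h₁ h₂
  admissible_right := isPureAdmissible_of_exactOnSystems h₂₁ h₃₂ h₂ h₃
  shortExact := by
    refine (h₂.solvesSystems_subtype h₂₁).isPureShortExact ?_ (Submodule.mkQ_surjective _)
    intro x
    simp only [Submodule.mkQ_apply, Submodule.Quotient.mk_eq_zero, Submodule.coe_subtype,
      Subtype.range_coe_subtype, LinearMap.mem_ker]
    constructor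
    · rintro ⟨a, rfl⟩
      exact LinearMap.congr_fun h₁₀ a
    · exact fun hx => h₁.exists_eq hx

end

theorem exists_comp_eq_of_injective {i : A →ₗ[R] B} (hi : Function.Injective i) (h : C →ₗ[R] B)
    (hh : ∀ x, ∃ a, i a = h x) : ∃ k : C →ₗ[R] A, i ∘ₗ k = h := by
  refine ⟨(LinearEquiv.ofInjective i hi).symm.toLinearMap ∘ₗ h.codRestrict _ hh,
    LinearMap.ext fun x => ?_⟩
  have := (LinearEquiv.ofInjective i hi).apply_symm_apply (h.codRestrict _ hh x)
  exact congrArg Subtype.val this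

theorem exists_comp_eq_of_surjective {p : A →ₗ[R] B} (hp : Function.Surjective p)
    (h : A →ₗ[R] C) (hh : ∀ x, p x = 0 → h x = 0) : ∃ k : B →ₗ[R] C, k ∘ₗ p = h := by
  refine ⟨(LinearMap.ker p).liftQ h hh ∘ₗ (p.quotKerEquivOfSurjective hp).symm.toLinearMap,
    LinearMap.ext fun x => ?_⟩
  have : (p.quotKerEquivOfSurjective hp).symm (p x) = Submodule.Quotient.mk x := by
    rw [LinearEquiv.symm_apply_eq]; rfl
  simp only [LinearMap.comp_apply, LinearEquiv.coe_coe, this]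
  rfl

theorem IsPureExactPair.ker_eq {d : A →ₗ[R] B} {e : B →ₗ[R] C} (h : IsPureExactPair d e) (x : B) :
    e x = 0 ↔ ∃ a, d a = x := by
  have := h.shortExact.exact x
  simpa using this.symm

end Pairs

section

variable {R : Type u} [Ring R] {A B C : Type u} [AddCommGroup A] [Module R A]
  [AddCommGroup B] [Module R B] [AddCommGroup C] [Module R C]

theorem IsPureExactPair.exists_lift {d : A →ₗ[R] B} {e : B →ₗ[R] C} (h : IsPureExactPair d e)
    {P : ModuleCat.{u} R} (hP : IsPureProjective P) (f : P →ₗ[R] B) (hf : e ∘ₗ f = 0) :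
    ∃ k : P →ₗ[R] A, d ∘ₗ k = f := by
  have hker := h.ker_eq
  obtain ⟨D, p, i, hp, hi, rfl⟩ := h.admissible_left
  obtain ⟨f', rfl⟩ := exists_comp_eq_of_injective hi.injective f fun x => by
    obtain ⟨a, ha⟩ := (hker (f x)).1 (LinearMap.congr_fun hf x)
    exact ⟨p a, ha⟩
  obtain ⟨k, rfl⟩ := hP.exists_lift hp.surjective hp.liftsSystems f'
  exact ⟨k, rfl⟩

theorem IsPureExactPair.exists_extension {d : A →ₗ[R] B} {e : B →ₗ[R] C}
    (h : IsPureExactPair d e) {E : ModuleCat.{u} R} (hE : IsPureInjective E) (f : B →ₗ[R] E)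
    (hf : f ∘ₗ d = 0) : ∃ k : C →ₗ[R] E, k ∘ₗ e = f := by
  have hker := h.ker_eq
  obtain ⟨D, p, i, hp, hi, rfl⟩ := h.admissible_right
  obtain ⟨f', rfl⟩ := exists_comp_eq_of_surjective hp.surjective f fun x hx => by
    obtain ⟨a, rfl⟩ := (hker x).1 (by simp [hx])
    exact LinearMap.congr_fun hf a
  obtain ⟨k, rfl⟩ := hE.exists_extension hi.solvesSystems f'
  exact ⟨k, rfl⟩

end

/-! ### Pure exactness tested by Hom from pure projectives and into pure injectives -/

section Complexes

variable {R : Type u} [Ring R]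

/-- `Hom_R(M, X)` is exact in degree `n`. -/
def LiftsAt (M : ModuleCat.{u} R) (X : CochainComplex (ModuleCat.{u} R) ℤ) (n : ℤ) : Prop :=
  ∀ (i k : ℤ) (_ : i + 1 = n) (_ : n + 1 = k) (h : M ⟶ X.X n), h ≫ X.d n k = 0 →
    ∃ l : M ⟶ X.X i, l ≫ X.d i n = h

/-- `Hom_R(X, E)` is exact in degree `-n`. -/
def ExtendsAt (E : ModuleCat.{u} R) (X : CochainComplex (ModuleCat.{u} R) ℤ) (n : ℤ) : Prop :=
  ∀ (i k : ℤ) (_ : i + 1 = n) (_ : n + 1 = k) (h : X.X n ⟶ E), X.d i n ≫ h = 0 →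
    ∃ l : X.X k ⟶ E, X.d n k ≫ l = h

variable {X : CochainComplex (ModuleCat.{u} R) ℤ}

theorem PureExactAt.liftsAt {n : ℤ} (h : PureExactAt X n) {P : ModuleCat.{u} R}
    (hP : IsPureProjective P) : LiftsAt P X n := by
  intro i k hi hk f hf
  obtain rfl : i = n - 1 := by lia
  subst hk
  obtain ⟨l, hl⟩ := IsPureExactPair.exists_lift h hP f.hom (by
    rw [← ModuleCat.hom_comp, hf, ModuleCat.hom_zero])
  exact ⟨ModuleCat.ofHom l, ModuleCat.hom_ext hl⟩

theorem PureExactAt.extendsAt {n : ℤ} (h : PureExactAt X n) {E : ModuleCat.{u} R}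
    (hE : IsPureInjective E) : ExtendsAt E X n := by
  intro i k hi hk f hf
  obtain rfl : i = n - 1 := by lia
  subst hk
  obtain ⟨l, hl⟩ := IsPureExactPair.exists_extension h hE f.hom (by
    rw [← ModuleCat.hom_comp, hf, ModuleCat.hom_zero])
  exact ⟨ModuleCat.ofHom l, ModuleCat.hom_ext hl⟩

theorem exactOnSystems_of_liftsAt {i j k : ℤ} (hi : i + 1 = j) (hk : j + 1 = k)
    (h : ∀ P : ModuleCat.{u} R, IsPureProjective P → LiftsAt P X j) :
    ExactOnSystems (X.d i j).hom (X.d j k).hom := by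
  classical
  intro ι κ _ _ r c hc hr
  obtain ⟨f, hf⟩ := systemModule.exists_lift r c hr
  obtain ⟨l, hl⟩ := h _ (isPureProjective_systemModule r) i k hi hk (ModuleCat.ofHom f) (by
    ext1
    exact systemModule.hom_ext fun q => (congrArg (X.d j k).hom (hf q)).trans (hc q))
  refine ⟨fun j => l (systemModule.gen r j), fun j => ?_, fun i => ?_⟩
  · rw [← hf j]
    exact LinearMap.congr_fun (congrArg ModuleCat.Hom.hom hl) _
  · simp_rw [← map_smul, ← map_sum, systemModule.relation, map_zero]

/-- The hypothesis extends every map from `Coker (X.d i j)` to a pure injective along the induced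
map to `X.X k`, which is therefore a pure embedding. -/
theorem coexactOnSystems_of_extendsAt {i j k : ℤ} (hi : i + 1 = j) (hk : j + 1 = k)
    (h : ∀ E : ModuleCat.{u} R, IsPureInjective E → ExtendsAt E X j) :
    CoexactOnSystems (X.d i j).hom (X.d j k).hom := by
  have hd : (X.d j k).hom ∘ₗ (X.d i j).hom = 0 := by
    rw [← ModuleCat.hom_comp, X.d_comp_d, ModuleCat.hom_zero]
  let f : (X.X j ⧸ LinearMap.range (X.d i j).hom) →ₗ[R] X.X k :=
    Submodule.liftQ _ (X.d j k).hom (by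
      rw [LinearMap.range_le_ker_iff, hd])
  have hf : SolvesSystems f := by
    refine solvesSystems_of_forall_isPureInjective fun E hE g => ?_
    obtain ⟨l, hl⟩ := h E hE i k hi hk
      (ModuleCat.ofHom (g ∘ₗ (LinearMap.range (X.d i j).hom).mkQ)) (by
        ext1
        rw [ModuleCat.hom_comp, ModuleCat.hom_ofHom, LinearMap.comp_assoc,
          LinearMap.range_mkQ_comp, LinearMap.comp_zero, ModuleCat.hom_zero])
    refine ⟨l.hom, Submodule.linearMap_qext _ ?_⟩
    rw [LinearMap.comp_assoc, Submodule.liftQ_mkQ]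
    exact congrArg ModuleCat.Hom.hom hl
  intro ι κ _ _ r a b hb
  obtain ⟨x, hx⟩ := hf ι κ r (fun i => Submodule.Quotient.mk (a i)) b fun i => by
    rw [hb]; rfl
  choose y hy using fun j => Submodule.Quotient.mk_surjective _ (x j)
  refine ⟨y, fun i => ?_⟩
  rw [← Submodule.Quotient.mk_eq_zero, Submodule.Quotient.mk_sub, sub_eq_zero, ← hx i]
  simp only [← hy, ← Submodule.mkQ_apply, map_sum, map_smul]

theorem d_hom_comp (i j k : ℤ) : (X.d j k).hom ∘ₗ (X.d i j).hom = 0 := by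
  rw [← ModuleCat.hom_comp, X.d_comp_d, ModuleCat.hom_zero]

theorem pureExact_of_exactOnSystems
    (h : ∀ i j k, i + 1 = j → j + 1 = k → ExactOnSystems (X.d i j).hom (X.d j k).hom) :
    PureExact X := fun n =>
  isPureExactPair_of_exactOnSystems (d_hom_comp _ _ _) (d_hom_comp _ _ (n + 1 + 1))
    (d_hom_comp _ _ (n + 1 + 1 + 1)) (h _ _ _ (by lia) rfl) (h _ _ _ rfl rfl) (h _ _ _ rfl rfl)

variable (X) in
theorem pureExact_iff_liftsAt :
    PureExact X ↔ ∀ P : ModuleCat.{u} R, IsPureProjective P → ∀ n, LiftsAt P X n :=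
  ⟨fun h _ hP n => (h n).liftsAt hP, fun h => pureExact_of_exactOnSystems fun _ j _ hi hk =>
    exactOnSystems_of_liftsAt hi hk fun P hP => h P hP j⟩

variable (X) in
theorem pureExact_iff_extendsAt :
    PureExact X ↔ ∀ E : ModuleCat.{u} R, IsPureInjective E → ∀ n, ExtendsAt E X n := by
  refine ⟨fun h _ hE n => (h n).extendsAt hE, fun h => pureExact_of_exactOnSystems
    fun i j k hi hk => ?_⟩
  have key : ∀ i j k, i + 1 = j → j + 1 = k → CoexactOnSystems (X.d i j).hom (X.d j k).hom :=
    fun _ j _ hi hk => coexactOnSystems_of_extendsAt hi hk fun E hE => h E hE j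
  exact exactOnSystems_of_coexactOnSystems (d_hom_comp (i - 2) (i - 1) i) (d_hom_comp _ _ _)
    (key _ _ _ (by lia) (by lia)) (key _ _ _ (by lia) hi) (key _ _ _ hi hk)

theorem exactOnSystems_of_pureExact (h : PureExact X) {i j k : ℤ} (hi : i + 1 = j)
    (hk : j + 1 = k) : ExactOnSystems (X.d i j).hom (X.d j k).hom :=
  exactOnSystems_of_liftsAt hi hk fun _ hP => (h j).liftsAt hP

end Complexes

/-! ### Orthogonality in the homotopy category -/

section
open CochainComplex CochainComplex.HomComplex Pretriangulated

variable {R : Type u} [Ring R]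

/-- The quotient functor to the homotopy category. -/
abbrev toHtpy (R : Type u) [Ring R] :
    CochainComplex (ModuleCat.{u} R) ℤ ⥤ HomotopyCategory (ModuleCat.{u} R) (ComplexShape.up ℤ) :=
  HomotopyCategory.quotient _ _

/-- The module `M` as a complex concentrated in degree `0`. -/
abbrev single₀ (M : ModuleCat.{u} R) : CochainComplex (ModuleCat.{u} R) ℤ :=
  (CochainComplex.singleFunctor (ModuleCat.{u} R) 0).obj M

/-- The cohomology of `Hom_R(X, Y)` vanishes in degree `n`. -/
def HomVanishes (X Y : CochainComplex (ModuleCat.{u} R) ℤ) (n : ℤ) : Prop :=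
  ∀ z : Cocycle X Y n, z ∈ coboundaries X Y n

section

variable {X Y : CochainComplex (ModuleCat.{u} R) ℤ} {n : ℤ}

theorem homVanishes_iff_subsingleton :
    HomVanishes X Y n ↔ ∀ x : CohomologyClass X Y n, x = 0 := by
  constructor
  · intro h x
    obtain ⟨z, rfl⟩ := x.mk_surjective
    exact (CohomologyClass.mk_eq_zero_iff z).2 (h z)
  · intro h z
    exact (CohomologyClass.mk_eq_zero_iff z).1 (h _)

theorem homVanishes_iff_isZero : HomVanishes X Y n ↔ IsZero ((HomComplex X Y).homology n) := by
  rw [homVanishes_iff_subsingleton]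
  constructor
  · intro h
    have : Subsingleton ((HomComplex X Y).homology n) :=
      ⟨fun a b => (homologyAddEquiv X Y n).injective ((h _).trans (h _).symm)⟩
    exact AddCommGrpCat.isZero_of_subsingleton _
  · intro h x
    have := AddCommGrpCat.subsingleton_of_isZero h
    rw [← (homologyAddEquiv X Y n).apply_symm_apply x,
      Subsingleton.elim ((homologyAddEquiv X Y n).symm x) 0, map_zero]

theorem homVanishes_iff_hom :
    HomVanishes X Y n ↔ ∀ f : (toHtpy R).obj X ⟶ ((toHtpy R).obj Y)⟦n⟧, f = 0 := by
  rw [homVanishes_iff_subsingleton]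
  let e := ((toHtpy R).commShiftIso n).app Y
  constructor
  · intro h f
    obtain ⟨x, hx⟩ := (CohomologyClass.toHom_bijective X Y n).surjective (f ≫ e.inv)
    rw [h x, map_zero] at hx
    rw [← cancel_mono e.inv, ← hx, zero_comp]
  · intro h x
    refine (CohomologyClass.toHom_bijective X Y n).injective ?_
    rw [map_zero, ← cancel_mono e.hom, zero_comp]
    exact h _

theorem homVanishes_single_left (M : ModuleCat.{u} R) :
    HomVanishes (single₀ M) Y n ↔ LiftsAt M Y n := by
  constructor
  · intro h i k hi hk f hf
    exact (Cocycle.fromSingleMk_mem_coboundaries_iff f (zero_add n) k hk hf i hi).1 (h _)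
  · intro h z
    obtain ⟨f, hf, rfl⟩ := Cocycle.fromSingleMk_surjective z n (zero_add n) (n + 1) rfl
    exact (Cocycle.fromSingleMk_mem_coboundaries_iff f (zero_add n) _ rfl hf (n - 1) (by lia)).2
      (h _ _ (by lia) rfl f hf)

theorem homVanishes_single_right (M : ModuleCat.{u} R) {m : ℤ} (hm : m + n = 0) :
    HomVanishes X (single₀ M) n ↔ ExtendsAt M X m := by
  constructor
  · intro h i k hi hk f hf
    exact (Cocycle.toSingleMk_mem_coboundaries_iff f hm i hi hf k hk).1 (h _)
  · intro h z
    obtain ⟨f, hf, rfl⟩ := Cocycle.toSingleMk_surjective z m hm (m - 1) (by lia)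
    exact (Cocycle.toSingleMk_mem_coboundaries_iff f hm _ (by lia) hf (m + 1) rfl).2
      (h _ _ (by lia) rfl f hf)

end

/-- The shifts of the pure projective modules, in the homotopy category. -/
def pureProjectiveShifts (R : Type u) [Ring R] :
    ObjectProperty (HomotopyCategory (ModuleCat.{u} R) (ComplexShape.up ℤ)) :=
  fun A => ∃ (P : ModuleCat.{u} R) (i : ℤ), IsPureProjective P ∧
    Nonempty (A ≅ ((toHtpy R).obj (single₀ P))⟦i⟧)

instance : (pureProjectiveShifts R).IsStableUnderShift ℤ where
  isStableUnderShiftBy n := ⟨by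
    rintro A ⟨P, i, hP, ⟨e⟩⟩
    exact ⟨P, i + n, hP, ⟨(CategoryTheory.shiftFunctor _ n).mapIso e ≪≫ ((shiftFunctorAdd _ i n).app _).symm⟩⟩⟩

/-- The pure exact complexes, as a triangulated subcategory of the homotopy category. -/
abbrev pureAcyclic (R : Type u) [Ring R] :
    ObjectProperty (HomotopyCategory (ModuleCat.{u} R) (ComplexShape.up ℤ)) :=
  (pureProjectiveShifts R).rightOrthogonal

/-- This identifies the pure exact complexes with a right orthogonal of a shift-stable class, so the
general theory of orthogonals in triangulated categories applies to them. The proof only moves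
shifts from source to target. -/
theorem pureAcyclic_iff (X : CochainComplex (ModuleCat.{u} R) ℤ) :
    pureAcyclic R ((toHtpy R).obj X) ↔ PureExact X := by
  rw [pureExact_iff_liftsAt]
  simp_rw [← homVanishes_single_left, homVanishes_iff_hom]
  constructor
  · intro h P hP n f
    refine (CategoryTheory.shiftFunctor _ (-n)).map_injective ?_
    rw [Functor.map_zero, ← cancel_mono (shiftShiftNeg ((toHtpy R).obj X) n).hom, zero_comp]
    exact h _ ⟨P, -n, hP, ⟨Iso.refl _⟩⟩
  · rintro h A f ⟨P, n, hP, ⟨e⟩⟩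
    rw [← cancel_epi e.inv, comp_zero]
    refine (CategoryTheory.shiftFunctor _ (-n)).map_injective ?_
    rw [Functor.map_zero, ← cancel_epi (shiftShiftNeg ((toHtpy R).obj (single₀ P)) n).inv,
      comp_zero]
    exact h P hP (-n) _

theorem trW_pureAcyclic_iff {X Y : CochainComplex (ModuleCat.{u} R) ℤ} (f : X ⟶ Y) :
    (pureAcyclic R).trW ((toHtpy R).map f) ↔ IsPureQuasiIso f := by
  rw [IsPureQuasiIso, ← pureAcyclic_iff]
  exact (pureAcyclic R).trW_iff_of_distinguished _
    (HomotopyCategory.mappingCone_triangleh_distinguished f)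

/-- Every map from `P` to a pure exact complex is null-homotopic. -/
def IsKPureProjective (P : CochainComplex (ModuleCat.{u} R) ℤ) : Prop :=
  (pureAcyclic R).leftOrthogonal ((toHtpy R).obj P)

/-- Every map from a pure exact complex to `I` is null-homotopic. -/
def IsKPureInjective (I : CochainComplex (ModuleCat.{u} R) ℤ) : Prop :=
  (pureAcyclic R).rightOrthogonal ((toHtpy R).obj I)

theorem isKPureProjective_of_homotopy {P : CochainComplex (ModuleCat.{u} R) ℤ}
    (h : ∀ (Z : CochainComplex (ModuleCat.{u} R) ℤ) (f : P ⟶ Z), PureExact Z →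
      Nonempty (Homotopy f 0)) : IsKPureProjective P := by
  intro Z f hZ
  obtain ⟨Z, rfl⟩ := HomotopyCategory.quotient_obj_surjective Z
  obtain ⟨f, rfl⟩ := (toHtpy R).map_surjective f
  exact (HomotopyCategory.quotient_map_eq_zero_iff f).2 (h Z f ((pureAcyclic_iff Z).1 hZ))

theorem isKPureInjective_of_homotopy {I : CochainComplex (ModuleCat.{u} R) ℤ}
    (h : ∀ (Z : CochainComplex (ModuleCat.{u} R) ℤ) (f : Z ⟶ I), PureExact Z →
      Nonempty (Homotopy f 0)) : IsKPureInjective I := by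
  intro Z f hZ
  obtain ⟨Z, rfl⟩ := HomotopyCategory.quotient_obj_surjective Z
  obtain ⟨f, rfl⟩ := (toHtpy R).map_surjective f
  exact (HomotopyCategory.quotient_map_eq_zero_iff f).2 (h Z f ((pureAcyclic_iff Z).1 hZ))

variable {X X' Y Y' P P' I I' : CochainComplex (ModuleCat.{u} R) ℤ}

theorem IsKPureProjective.homVanishes (hP : IsKPureProjective P) (hY : PureExact Y) (n : ℤ) :
    HomVanishes P Y n :=
  homVanishes_iff_hom.2 fun f => hP f
    ((pureAcyclic R).le_shift n _ ((pureAcyclic_iff Y).2 hY))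

theorem IsKPureInjective.homVanishes (hI : IsKPureInjective I) (hX : PureExact X) (n : ℤ) :
    HomVanishes X I n :=
  homVanishes_iff_hom.2 fun f => ((pureAcyclic R).rightOrthogonal.le_shift n _ hI) f
    ((pureAcyclic_iff X).2 hX)

theorem isKPureProjective_of_homVanishes
    (h : ∀ Z : CochainComplex (ModuleCat.{u} R) ℤ, PureExact Z → HomVanishes P Z 0) :
    IsKPureProjective P := by
  intro Z f hZ
  obtain ⟨Z, rfl⟩ := HomotopyCategory.quotient_obj_surjective Z
  let e := (shiftFunctorZero _ ℤ).app ((toHtpy R).obj Z)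
  rw [← cancel_mono e.inv, zero_comp]
  exact homVanishes_iff_hom.1 (h Z ((pureAcyclic_iff Z).1 hZ)) _

theorem isKPureInjective_of_homVanishes
    (h : ∀ Z : CochainComplex (ModuleCat.{u} R) ℤ, PureExact Z → HomVanishes Z I 0) :
    IsKPureInjective I := by
  intro Z f hZ
  obtain ⟨Z, rfl⟩ := HomotopyCategory.quotient_obj_surjective Z
  let e := (shiftFunctorZero _ ℤ).app ((toHtpy R).obj I)
  rw [← cancel_mono e.inv, zero_comp]
  exact homVanishes_iff_hom.1 (h Z ((pureAcyclic_iff Z).1 hZ)) _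

/-- Left orthogonality to the pure exact complexes is colocality for the maps whose cone is pure
exact; shifting `f` covers every degree. -/
theorem IsKPureProjective.homVanishes_iff (hP : IsKPureProjective P) {f : Y ⟶ Y'}
    (hf : IsPureQuasiIso f) (n : ℤ) : HomVanishes P Y n ↔ HomVanishes P Y' n := by
  have h : (pureAcyclic R).trW.isColocal ((toHtpy R).obj P) := by
    rw [ObjectProperty.isColocal_trW]
    exact hP
  have hb := h _ (((trW_pureAcyclic_iff f).2 hf).shift n)
  rw [homVanishes_iff_hom, homVanishes_iff_hom]
  constructor
  · intro H g
    obtain ⟨k, rfl⟩ := hb.surjective g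
    simp [H k]
  · intro H g
    exact hb.injective ((H _).trans (H _).symm)

theorem IsKPureInjective.homVanishes_iff (hI : IsKPureInjective I) {f : X ⟶ X'}
    (hf : IsPureQuasiIso f) (n : ℤ) : HomVanishes X I n ↔ HomVanishes X' I n := by
  have h : (pureAcyclic R).trW.isLocal (((toHtpy R).obj I)⟦n⟧) := by
    rw [ObjectProperty.isLocal_trW]
    exact (pureAcyclic R).rightOrthogonal.le_shift n _ hI
  have hb := h _ ((trW_pureAcyclic_iff f).2 hf)
  rw [homVanishes_iff_hom, homVanishes_iff_hom]
  constructor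
  · intro H g
    exact hb.injective ((H _).trans (H _).symm)
  · intro H g
    obtain ⟨k, rfl⟩ := hb.surjective g
    simp [H k]

/-- Colocality of `Y` gives a right inverse `g`; colocality of `X` allows `f` to be cancelled from
`f g f = f`. -/
theorem IsKPureProjective.isIso {f : X ⟶ Y} (hX : IsKPureProjective X)
    (hY : IsKPureProjective Y) (hf : IsPureQuasiIso f) : IsIso ((toHtpy R).map f) := by
  have hX' : (pureAcyclic R).trW.isColocal ((toHtpy R).obj X) := by
    rw [ObjectProperty.isColocal_trW]; exact hX
  have hY' : (pureAcyclic R).trW.isColocal ((toHtpy R).obj Y) := by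
    rw [ObjectProperty.isColocal_trW]; exact hY
  have hW := (trW_pureAcyclic_iff f).2 hf
  obtain ⟨g, hg⟩ := (hY' _ hW).surjective (𝟙 _)
  refine ⟨g, (hX' _ hW).injective ?_, hg⟩
  dsimp only at hg ⊢
  rw [Category.assoc, hg, Category.comp_id, Category.id_comp]

theorem IsKPureInjective.isIso {f : X ⟶ Y} (hX : IsKPureInjective X)
    (hY : IsKPureInjective Y) (hf : IsPureQuasiIso f) : IsIso ((toHtpy R).map f) := by
  have hX' : (pureAcyclic R).trW.isLocal ((toHtpy R).obj X) := by
    rw [ObjectProperty.isLocal_trW]; exact hX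
  have hY' : (pureAcyclic R).trW.isLocal ((toHtpy R).obj Y) := by
    rw [ObjectProperty.isLocal_trW]; exact hY
  have hW := (trW_pureAcyclic_iff f).2 hf
  obtain ⟨g, hg⟩ := (hX' _ hW).surjective (𝟙 _)
  refine ⟨g, hg, (hY' _ hW).injective ?_⟩
  dsimp only at hg ⊢
  rw [← Category.assoc, hg, Category.comp_id, Category.id_comp]

/-- A pure quasi-isomorphism from a K-pure projective complex can be transported along a pure
quasi-isomorphism of K-pure projective complexes. -/
theorem IsKPureProjective.exists_pureQuasiIso {π : P ⟶ X} {f : P ⟶ P'}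
    (hP : IsKPureProjective P) (hP' : IsKPureProjective P') (hπ : IsPureQuasiIso π)
    (hf : IsPureQuasiIso f) : ∃ π' : P' ⟶ X, IsPureQuasiIso π' := by
  have := hP.isIso hP' hf
  obtain ⟨g, hg⟩ := (toHtpy R).map_surjective (inv ((toHtpy R).map f) ≫ (toHtpy R).map π)
  refine ⟨g, ?_⟩
  rw [← trW_pureAcyclic_iff, hg]
  exact ((pureAcyclic R).trW.cancel_left_of_respectsIso _ _).2 ((trW_pureAcyclic_iff π).2 hπ)

/-- A pure quasi-isomorphism to a K-pure injective complex can be transported along a pure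
quasi-isomorphism of K-pure injective complexes. -/
theorem IsKPureInjective.exists_pureQuasiIso {ι : Y ⟶ I} {f : I' ⟶ I}
    (hI : IsKPureInjective I) (hI' : IsKPureInjective I') (hι : IsPureQuasiIso ι)
    (hf : IsPureQuasiIso f) : ∃ ι' : Y ⟶ I', IsPureQuasiIso ι' := by
  have := hI'.isIso hI hf
  obtain ⟨g, hg⟩ := (toHtpy R).map_surjective ((toHtpy R).map ι ≫ inv ((toHtpy R).map f))
  refine ⟨g, ?_⟩
  rw [← trW_pureAcyclic_iff, hg]
  exact ((pureAcyclic R).trW.cancel_right_of_respectsIso _ _).2 ((trW_pureAcyclic_iff ι).2 hι)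

end

/-! ### Maps into and out of mapping cones -/

section Cone

open CochainComplex

variable {R : Type u} [Ring R] {X Y : CochainComplex (ModuleCat.{u} R) ℤ}

/-- A map into the cone is a pair `(x, y)` with differential `(-dx, f x + dy)`; this is the source
of the sign in `-x`. -/
theorem liftsAt_mappingCone (f : X ⟶ Y) (P : ModuleCat.{u} R) (i n k m : ℤ) (hi : i + 1 = n)
    (hk : n + 1 = k) (hm : k + 1 = m)
    (H : ∀ (x : P ⟶ X.X k) (y : P ⟶ Y.X n), x ≫ X.d k m = 0 → x ≫ f.f k + y ≫ Y.d n k = 0 →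
      ∃ (x' : P ⟶ X.X n) (y' : P ⟶ Y.X i), x' ≫ X.d n k = -x ∧ x' ≫ f.f n + y' ≫ Y.d i n = y) :
    LiftsAt P (mappingCone f) n := by
  intro i' k' hi' hk' h hd
  obtain rfl : i' = i := by lia
  obtain rfl : k' = k := by lia
  obtain ⟨x', y', hx, hy⟩ := H (h ≫ (mappingCone.fst f).1.v n k' hk)
    (h ≫ (mappingCone.snd f).v n n (add_zero n))
    (by
      have := hd =≫ (mappingCone.fst f).1.v k' m hm
      rw [Category.assoc, mappingCone.d_fst_v f n k' m hk hm, zero_comp, Preadditive.comp_neg,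
        neg_eq_zero, ← Category.assoc] at this
      exact this)
    (by
      have := hd =≫ (mappingCone.snd f).v k' k' (add_zero k')
      rw [Category.assoc, mappingCone.d_snd_v f n k' hk, zero_comp, Preadditive.comp_add] at this
      simpa only [Category.assoc] using this)
  refine ⟨x' ≫ (mappingCone.inl f).v n i' (by lia) + y' ≫ (mappingCone.inr f).f i', ?_⟩
  rw [Preadditive.add_comp, Category.assoc, Category.assoc,
    mappingCone.inl_v_d f n i' k' (by lia) (by lia), mappingCone.inr_f_d,
    mappingCone.ext_to_iff f n k' hk]
  constructor
  · simp [hx]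
  · simpa using hy

theorem extendsAt_mappingCone (f : X ⟶ Y) (E : ModuleCat.{u} R) (i n k m : ℤ) (hi : i + 1 = n)
    (hk : n + 1 = k) (hm : k + 1 = m)
    (H : ∀ (x : X.X k ⟶ E) (y : Y.X n ⟶ E), Y.d i n ≫ y = 0 → f.f n ≫ y = X.d n k ≫ x →
      ∃ (x' : X.X m ⟶ E) (y' : Y.X k ⟶ E), Y.d n k ≫ y' = y ∧ f.f k ≫ y' - X.d k m ≫ x' = x) :
    ExtendsAt E (mappingCone f) n := by
  intro i' k' hi' hk' h hd
  obtain rfl : i' = i := by lia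
  obtain rfl : k' = k := by lia
  obtain ⟨x', y', hy, hx⟩ := H ((mappingCone.inl f).v k' n (by lia) ≫ h)
    ((mappingCone.inr f).f n ≫ h)
    (by rw [← mappingCone.inr_f_d_assoc, hd, comp_zero])
    (by
      have := (mappingCone.inl f).v n i' (by lia) ≫= hd
      rw [← Category.assoc, mappingCone.inl_v_d f n i' k' (by lia) (by lia), comp_zero,
        Preadditive.sub_comp, Category.assoc, Category.assoc, sub_eq_zero] at this
      exact this)
  refine ⟨(mappingCone.fst f).1.v k' m hm ≫ x' +
    (mappingCone.snd f).v k' k' (add_zero k') ≫ y', ?_⟩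
  rw [Preadditive.comp_add, ← Category.assoc, ← Category.assoc,
    mappingCone.d_fst_v f n k' m hk hm, mappingCone.d_snd_v f n k' hk,
    mappingCone.ext_from_iff f k' n hk]
  constructor
  · simp only [Preadditive.comp_add, Preadditive.add_comp, Preadditive.neg_comp,
      Preadditive.comp_neg, Category.assoc, mappingCone.inl_v_fst_v_assoc,
      mappingCone.inl_v_snd_v_assoc, zero_comp, add_zero]
    rw [← hx]
    abel
  · simpa using hy

end Cone

/-! ### Subcomplexes, quotient complexes and canonical truncations -/

section Subquotients

variable {R : Type u} [Ring R] (X : CochainComplex (ModuleCat.{u} R) ℤ)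
  (K : ∀ i, Submodule R (X.X i)) (hK : ∀ i j, ∀ x ∈ K i, (X.d i j).hom x ∈ K j)

/-- The subcomplex given by a family of submodules stable under the differential. -/
def subcomplex : CochainComplex (ModuleCat.{u} R) ℤ where
  X i := ModuleCat.of R (K i)
  d i j := ModuleCat.ofHom ((X.d i j).hom.restrict (hK i j))
  shape i j hij := by
    ext x
    change (X.d i j).hom x.1 = 0
    rw [X.shape i j hij]
    rfl
  d_comp_d' i j k _ _ := by
    ext x
    exact LinearMap.congr_fun (d_hom_comp (X := X) i j k) x.1

/-- The inclusion of a subcomplex. -/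
def subcomplex.ι : subcomplex X K hK ⟶ X where
  f i := ModuleCat.ofHom (K i).subtype
  comm' _ _ _ := rfl

/-- The quotient complex by a family of submodules stable under the differential. -/
def quotientComplex : CochainComplex (ModuleCat.{u} R) ℤ where
  X i := ModuleCat.of R (X.X i ⧸ K i)
  d i j := ModuleCat.ofHom ((K i).mapQ (K j) (X.d i j).hom (hK i j))
  shape i j hij := by
    ext1
    refine Submodule.linearMap_qext _ (LinearMap.ext fun x => ?_)
    change (K j).mkQ ((X.d i j).hom x) = 0
    rw [X.shape i j hij]
    exact map_zero _
  d_comp_d' i j k _ _ := by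
    ext1
    refine Submodule.linearMap_qext _ (LinearMap.ext fun x => ?_)
    exact (congrArg (K k).mkQ (LinearMap.congr_fun (d_hom_comp (X := X) i j k) x)).trans
      (map_zero _)

/-- The projection to a quotient complex. -/
def quotientComplex.π : X ⟶ quotientComplex X K hK where
  f i := ModuleCat.ofHom (K i).mkQ
  comm' _ _ _ := rfl

end Subquotients

section Truncation

variable {R : Type u} [Ring R] (X : CochainComplex (ModuleCat.{u} R) ℤ) (s : ℤ)

/-- The submodules of the canonical truncation `τ_{≤ s}`. -/
def truncLESubmodule (i : ℤ) : Submodule R (X.X i) where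
  carrier := {x | (s ≤ i → (X.d i (i + 1)).hom x = 0) ∧ (s < i → x = 0)}
  zero_mem' := by simp
  add_mem' := by
    rintro x y ⟨hx, hx'⟩ ⟨hy, hy'⟩
    refine ⟨fun h => ?_, fun h => ?_⟩
    · rw [map_add, hx h, hy h, add_zero]
    · rw [hx' h, hy' h, add_zero]
  smul_mem' := by
    rintro r x ⟨hx, hx'⟩
    refine ⟨fun h => ?_, fun h => ?_⟩
    · rw [map_smul, hx h, smul_zero]
    · rw [hx' h, smul_zero]

theorem truncLESubmodule_d (i j : ℤ) (x : X.X i) (hx : x ∈ truncLESubmodule X s i) :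
    (X.d i j).hom x ∈ truncLESubmodule X s j := by
  refine ⟨fun _ => LinearMap.congr_fun (d_hom_comp (X := X) i j (j + 1)) x, fun h => ?_⟩
  by_cases hij : i + 1 = j
  · subst hij
    exact hx.1 (by lia)
  · rw [X.shape i j hij]
    rfl

/-- The canonical truncation `τ_{≤ s} X`. -/
abbrev truncLE : CochainComplex (ModuleCat.{u} R) ℤ :=
  subcomplex X (truncLESubmodule X s) (truncLESubmodule_d X s)

/-- The inclusion of `τ_{≤ s} X` in `X`. -/
abbrev truncLE.ι : truncLE X s ⟶ X := subcomplex.ι _ _ _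

/-- The submodules of the kernel of `X ⟶ τ_{≥ s} X`. -/
def truncGESubmodule (i : ℤ) : Submodule R (X.X i) :=
  if i < s then ⊤ else if i = s then LinearMap.range (X.d (i - 1) i).hom else ⊥

theorem truncGESubmodule_d (i j : ℤ) (x : X.X i) (hx : x ∈ truncGESubmodule X s i) :
    (X.d i j).hom x ∈ truncGESubmodule X s j := by
  by_cases hij : i + 1 = j
  · obtain rfl : i = j - 1 := by lia
    by_cases h₁ : j < s
    · simp [truncGESubmodule, h₁]
    by_cases h₂ : j = s
    · simp [truncGESubmodule, h₂]
    · rw [truncGESubmodule, if_neg (by lia)] at hx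
      suffices (X.d (j - 1) j).hom x = 0 by
        rw [this]
        exact zero_mem _
      split_ifs at hx
      · obtain ⟨y, rfl⟩ := hx
        exact LinearMap.congr_fun (d_hom_comp (X := X) _ _ _) y
      · rw [(Submodule.mem_bot _).1 hx, map_zero]
  · rw [X.shape i j hij]
    exact zero_mem _

/-- The canonical truncation `τ_{≥ s} X`. -/
abbrev truncGE : CochainComplex (ModuleCat.{u} R) ℤ :=
  quotientComplex X (truncGESubmodule X s) (truncGESubmodule_d X s)

/-- The projection of `X` to `τ_{≥ s} X`. -/
abbrev truncGE.π : X ⟶ truncGE X s := quotientComplex.π _ _ _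

variable {X s}

theorem isZero_truncLE {i : ℤ} (h : s < i) : IsZero ((truncLE X s).X i) := by
  have : Subsingleton (truncLESubmodule X s i) :=
    ⟨fun x y => Subtype.ext ((x.2.2 h).trans (y.2.2 h).symm)⟩
  exact ModuleCat.isZero_of_subsingleton (ModuleCat.of R (truncLESubmodule X s i))

theorem isZero_truncGE {i : ℤ} (h : i < s) : IsZero ((truncGE X s).X i) := by
  have : Subsingleton (X.X i ⧸ truncGESubmodule X s i) := by
    rw [Submodule.Quotient.subsingleton_iff, truncGESubmodule, if_pos h]
  exact ModuleCat.isZero_of_subsingleton (ModuleCat.of R (X.X i ⧸ truncGESubmodule X s i))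

theorem isPureQuasiIso_truncLE (h : ∀ P : ModuleCat.{u} R, IsPureProjective P →
    ∀ n, s < n → LiftsAt P X n) : IsPureQuasiIso (truncLE.ι X s) := by
  refine (pureExact_iff_liftsAt _).2 fun P hP n =>
    liftsAt_mappingCone _ P (n - 1) n (n + 1) (n + 2) (by lia) rfl (by lia) ?_
  intro x y hx hxy
  by_cases hn : s < n
  · have hx0 : x = 0 := (isZero_truncLE (X := X) (by lia : s < n + 1)).eq_of_tgt _ _
    subst hx0
    rw [zero_comp, zero_add] at hxy
    obtain ⟨l, hl⟩ := h P hP n hn (n - 1) (n + 1) (by lia) rfl y hxy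
    exact ⟨0, l, by simp, by simp [hl]⟩
  -- For `n ≤ s` the component `y` already lies in the truncation: only `n = s` needs an argument,
  -- and there `x` has zero target, so `y` is a cycle.
  · have hy (p : P) : y.hom p ∈ truncLESubmodule X s n := by
      refine ⟨fun hs => ?_, fun hs => absurd hs hn⟩
      have hx0 : x = 0 := (isZero_truncLE (X := X) (by lia : s < n + 1)).eq_of_tgt _ _
      subst hx0
      rw [zero_comp, zero_add] at hxy
      exact LinearMap.congr_fun (congrArg ModuleCat.Hom.hom hxy) p
    refine ⟨ModuleCat.ofHom (y.hom.codRestrict _ hy), 0, ?_, ?_⟩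
    · ext p
      refine Subtype.ext ?_
      have := LinearMap.congr_fun (congrArg ModuleCat.Hom.hom hxy) p
      exact eq_neg_of_add_eq_zero_right this
    · rw [zero_comp, add_zero]
      rfl

theorem isPureQuasiIso_truncGE (h : ∀ E : ModuleCat.{u} R, IsPureInjective E →
    ∀ n, n < s → ExtendsAt E X n) : IsPureQuasiIso (truncGE.π X s) := by
  refine (pureExact_iff_extendsAt _).2 fun E hE n =>
    extendsAt_mappingCone _ E (n - 1) n (n + 1) (n + 2) (by lia) rfl (by lia) ?_
  intro x y hy hxy
  by_cases hn : n + 1 < s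
  · have hy0 : y = 0 := (isZero_truncGE (X := X) (by lia : n < s)).eq_of_src _ _
    subst hy0
    rw [comp_zero] at hxy
    obtain ⟨l, hl⟩ := h E hE (n + 1) hn n (n + 2) rfl (by lia) x hxy.symm
    exact ⟨-l, 0, by simp, by simp [hl]⟩
  -- For `s ≤ n + 1` the map `x` itself descends to the quotient: only `n + 1 = s` needs an
  -- argument, and there `y` has zero source, so `x` kills the boundaries.
  · have hx : truncGESubmodule X s (n + 1) ≤ LinearMap.ker x.hom := by
      rw [truncGESubmodule, if_neg hn]
      split_ifs with hs
      · have hy0 : y = 0 := (isZero_truncGE (X := X) (by lia : n < s)).eq_of_src _ _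
        subst hy0
        rw [comp_zero] at hxy
        have key : ∀ m, m = n → ∀ z : X.X m, x.hom ((X.d m (n + 1)).hom z) = 0 := by
          rintro _ rfl z
          exact (LinearMap.congr_fun (congrArg ModuleCat.Hom.hom hxy) z).symm
        rintro _ ⟨z, rfl⟩
        exact key _ (by lia) z
      · exact bot_le
    let l : (truncGE X s).X (n + 1) ⟶ E := ModuleCat.ofHom (Submodule.liftQ _ x.hom hx)
    have hl : (truncGE.π X s).f (n + 1) ≫ l = x := by
      ext1
      exact Submodule.liftQ_mkQ _ _ _
    refine ⟨0, l, ?_, by simp [hl]⟩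
    have hepi : Epi ((truncGE.π X s).f n) :=
      (ModuleCat.epi_iff_surjective _).2 (Submodule.mkQ_surjective _)
    rw [← cancel_epi ((truncGE.π X s).f n), HomologicalComplex.Hom.comm_assoc, hl, hxy]

end Truncation

/-! ### When truncations keep pure injective or pure projective terms -/

section TruncationTerms

variable {R : Type u} [Ring R] {X : CochainComplex (ModuleCat.{u} R) ℤ} {s : ℤ}

/-- Only the kernel in degree `s` matters. Extend `A → Ker d` to `b : B → X^s`; then `d b` factors
through a cycle `c : C → X^{s+1}`, which lifts to `l`, and `b - l g` takes values in the kernel. As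
`C` is an arbitrary module, exactness of `Hom(M, X)` is required for every `M`. -/
theorem isPureInjective_truncLE (hX : ∀ i, IsPureInjective (X.X i))
    (h : ∀ M : ModuleCat.{u} R, LiftsAt M X (s + 1)) (i : ℤ) :
    IsPureInjective ((truncLE X s).X i) := by
  obtain hi | rfl | hi := lt_trichotomy i s
  · refine (hX i).of_retract (truncLESubmodule X s i).subtype
      (LinearMap.id.codRestrict _ fun x => ⟨fun h => absurd h (by lia), fun h => absurd h (by lia)⟩)
      (LinearMap.ext fun x => rfl)
  · intro A B C f g hfg a
    obtain ⟨b, hb⟩ := hX i A B C f g hfg ((truncLESubmodule X i i).subtype ∘ₗ a)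
    obtain ⟨c, hc⟩ := exists_comp_eq_of_surjective hfg.surjective ((X.d i (i + 1)).hom ∘ₗ b)
      fun x hx => by
        obtain ⟨y, rfl⟩ := (hfg.exact x).1 hx
        have := LinearMap.congr_fun hb y
        simp only [LinearMap.comp_apply] at this ⊢
        rw [this]
        exact (a y).2.1 le_rfl
    obtain ⟨l, hl⟩ := h C i (i + 2) rfl (by lia) (ModuleCat.ofHom c) (by
      ext z
      obtain ⟨x, rfl⟩ := hfg.surjective z
      have h₁ := LinearMap.congr_fun hc x
      have h₂ := LinearMap.congr_fun (d_hom_comp (X := X) i (i + 1) (i + 2)) (b x)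
      exact (congrArg (X.d (i + 1) (i + 2)).hom h₁).trans h₂)
    have hl' : (X.d i (i + 1)).hom ∘ₗ l.hom = c := congrArg ModuleCat.Hom.hom hl
    refine ⟨(b - l.hom ∘ₗ g).codRestrict _ fun x => ⟨fun _ => ?_, fun h => absurd h (lt_irrefl _)⟩,
      LinearMap.ext fun x => Subtype.ext ?_⟩
    · have h₁ := LinearMap.congr_fun hc x
      have h₂ := LinearMap.congr_fun hl' (g x)
      simp only [LinearMap.comp_apply] at h₁ h₂
      simp [h₁, h₂]
    · have h₁ := LinearMap.congr_fun hb x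
      change b (f x) - l.hom (g (f x)) = (a x).1
      rw [hfg.exact.apply_apply_eq_zero, map_zero, sub_zero]
      exact h₁
  · have := ModuleCat.subsingleton_of_isZero (isZero_truncLE (X := X) hi)
    exact isPureInjective_of_subsingleton _

/-- Dually, only the cokernel in degree `s` matters: a lift `b` on `X^s` is corrected by `f l`,
where `l` extends the map `X^{s-1} → A` induced by `b d`. -/
theorem isPureProjective_truncGE (hX : ∀ i, IsPureProjective (X.X i))
    (h : ∀ M : ModuleCat.{u} R, ExtendsAt M X (s - 1)) (i : ℤ) :
    IsPureProjective ((truncGE X s).X i) := by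
  obtain hi | rfl | hi := lt_trichotomy i s
  · have := ModuleCat.subsingleton_of_isZero (isZero_truncGE (X := X) hi)
    exact isPureProjective_of_subsingleton _
  · have hK : truncGESubmodule X i i = LinearMap.range (X.d (i - 1) i).hom := by
      simp [truncGESubmodule]
    intro A B C f g hfg c
    obtain ⟨b, hb⟩ := hX i A B C f g hfg (c ∘ₗ (truncGESubmodule X i i).mkQ)
    obtain ⟨a, ha⟩ := exists_comp_eq_of_injective hfg.injective (b ∘ₗ (X.d (i - 1) i).hom)
      fun x => by
        refine (hfg.exact _).1 ?_
        have := LinearMap.congr_fun hb ((X.d (i - 1) i).hom x)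
        simp only [LinearMap.comp_apply] at this ⊢
        rw [this]
        refine (congrArg c ?_).trans (map_zero c)
        exact (Submodule.Quotient.mk_eq_zero _).2 (hK ▸ LinearMap.mem_range_self _ x)
    obtain ⟨l, hl⟩ := h A (i - 2) i (by lia) (by lia) (ModuleCat.ofHom a) (by
      ext z
      refine hfg.injective ?_
      have h₁ := LinearMap.congr_fun ha ((X.d (i - 2) (i - 1)).hom z)
      have h₂ := LinearMap.congr_fun (d_hom_comp (X := X) (i - 2) (i - 1) i) z
      exact (h₁.trans ((congrArg b h₂).trans (map_zero b))).trans (map_zero f).symm)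
    have hl' : l.hom ∘ₗ (X.d (i - 1) i).hom = a := congrArg ModuleCat.Hom.hom hl
    refine ⟨Submodule.liftQ _ (b - f ∘ₗ l.hom) ?_, Submodule.linearMap_qext _
      (LinearMap.ext fun x => ?_)⟩
    · rw [hK]
      rintro _ ⟨x, rfl⟩
      have h₁ := LinearMap.congr_fun ha x
      have h₂ := LinearMap.congr_fun hl' x
      simp only [LinearMap.comp_apply] at h₁ h₂
      simp [h₁, h₂]
    · have h₁ := LinearMap.congr_fun hb x
      change g (b x - f (l.hom x)) = _
      rw [map_sub, hfg.exact.apply_apply_eq_zero, sub_zero]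
      exact h₁
  · have hK : truncGESubmodule X s i = ⊥ := by
      rw [truncGESubmodule, if_neg (by lia), if_neg (by lia)]
    let e := Submodule.quotEquivOfEqBot _ hK
    exact (hX i).of_retract e.toLinearMap e.symm.toLinearMap
      (LinearMap.ext fun x => e.symm_apply_apply x)

end TruncationTerms

/-! ### Families over `ℤ` built by one-sided recursion -/

section Recursion

variable {T : ℤ → Type w} (r : ∀ i j, T i → T j → Prop) (b : ℤ)

/-- The family obtained from `t₀` in degrees `> b` by a descending recursion. -/
def descendingFamily (t₀ : ∀ i, b < i → T i) (step : ∀ i, T (i + 1) → T i) (i : ℤ) : T i :=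
  if h : b < i then t₀ i h else step i (descendingFamily t₀ step (i + 1))
termination_by (b + 1 - i).toNat
decreasing_by lia

/-- The family obtained from `t₀` in degrees `< b` by an ascending recursion. -/
def ascendingFamily (t₀ : ∀ i, i < b → T i) (step : ∀ i j, i + 1 = j → T i → T j) (j : ℤ) : T j :=
  if h : j < b then t₀ j h else step (j - 1) j (by lia) (ascendingFamily t₀ step (j - 1))
termination_by (j - b + 1).toNat
decreasing_by lia

theorem exists_descendingFamily (t₀ : ∀ i, b < i → T i)
    (h₀ : ∀ i j (hij : i + 1 = j) (hi : b < i), r i j (t₀ i hi) (t₀ j (by lia)))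
    (hs : ∀ i j, i + 1 = j → ∀ t : T j, ∃ s : T i, r i j s t) :
    ∃ S : ∀ i, T i, (∀ i (hi : b < i), S i = t₀ i hi) ∧
      ∀ i j, i + 1 = j → r i j (S i) (S j) := by
  choose step hstep using fun i => hs i (i + 1) rfl
  refine ⟨descendingFamily b t₀ step, fun i hi => by rw [descendingFamily, dif_pos hi], ?_⟩
  rintro i _ rfl
  by_cases h : b < i
  · rw [descendingFamily, dif_pos h, descendingFamily, dif_pos (by lia)]
    exact h₀ _ _ rfl h
  · rw [descendingFamily, dif_neg h]
    exact hstep i _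

theorem exists_ascendingFamily (t₀ : ∀ i, i < b → T i)
    (h₀ : ∀ i j (hij : i + 1 = j) (hj : j < b), r i j (t₀ i (by lia)) (t₀ j hj))
    (hs : ∀ i j, i + 1 = j → ∀ s : T i, ∃ t : T j, r i j s t) :
    ∃ S : ∀ i, T i, (∀ i (hi : i < b), S i = t₀ i hi) ∧
      ∀ i j, i + 1 = j → r i j (S i) (S j) := by
  choose step hstep using hs
  refine ⟨ascendingFamily b t₀ step, fun i hi => by rw [ascendingFamily, dif_pos hi],
    fun i j hij => ?_⟩
  obtain rfl : i = j - 1 := by lia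
  by_cases h : j < b
  · rw [ascendingFamily, dif_pos (by lia), ascendingFamily, dif_pos h]
    exact h₀ _ _ hij h
  · rw [ascendingFamily.eq_def _ _ _ j, dif_neg h]
    exact hstep _ j hij _

end Recursion

/-! ### K-pure projectivity and K-pure injectivity of one-sidedly bounded complexes -/

section NullHomotopy

variable {R : Type u} [Ring R] {X Y : CochainComplex (ModuleCat.{u} R) ℤ}

theorem nonempty_homotopy_zero {f : X ⟶ Y} (s : ∀ i j, X.X i ⟶ Y.X j)
    (h₀ : ∀ i j, j + 1 ≠ i → s i j = 0)
    (h : ∀ i j k, i + 1 = j → j + 1 = k → s j i ≫ Y.d i j + X.d j k ≫ s k j = f.f j) :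
    Nonempty (Homotopy f 0) :=
  ⟨{  hom := s
      zero := fun i j hij => h₀ i j hij
      comm := fun i => by
        rw [dNext_eq s (show (ComplexShape.up ℤ).Rel i (i + 1) from rfl),
          prevD_eq s (show (ComplexShape.up ℤ).Rel (i - 1) i from by simp),
          HomologicalComplex.zero_f, add_zero, add_comm]
        exact (h (i - 1) i (i + 1) (by lia) rfl).symm }⟩

theorem isKPureProjective_of_bounded {P : CochainComplex (ModuleCat.{u} R) ℤ} {b : ℤ}
    (hb : ∀ i, b < i → IsZero (P.X i)) (hP : ∀ i, IsPureProjective (P.X i)) :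
    IsKPureProjective P := by
  refine isKPureProjective_of_homotopy fun Z f hZ => ?_
  -- The only possibly nonzero component of `s` is the one into degree `i - 1`. The second condition
  -- says that `f - d s` is a cycle in degree `i - 1`, which is what the next lift needs.
  let T (i : ℤ) := {s : ∀ j, P.X i ⟶ Z.X j // (∀ j, j + 1 ≠ i → s j = 0) ∧
    ∀ j, j + 1 = i → (f.f j - P.d j i ≫ s j) ≫ Z.d j i = 0}
  let r (i j : ℤ) (s : T i) (t : T j) : Prop :=
    ∀ k, k + 1 = i → s.1 k ≫ Z.d k i + P.d i j ≫ t.1 i = f.f i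
  obtain ⟨S, -, hS⟩ := exists_descendingFamily r b (fun i h => ⟨fun _ => 0, fun _ _ => rfl,
      fun j _ => by
        rw [comp_zero, sub_zero, f.comm, (hb i h).eq_of_src (f.f i) 0, comp_zero]⟩)
    (fun i j hij hi k hk => (hb i hi).eq_of_src _ _) (by
      rintro i j hij ⟨t, ht₀, ht⟩
      obtain ⟨l, hl⟩ := (hZ i).liftsAt (hP i) (i - 1) j (by lia) hij _ (ht i hij)
      refine ⟨⟨Pi.single (i - 1) l, fun k hk => Pi.single_eq_of_ne (by lia) _, fun k hk => ?_⟩,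
        fun k hk => ?_⟩
      · obtain rfl : k = i - 1 := by lia
        rw [Pi.single_eq_same, Preadditive.sub_comp, Category.assoc, hl, f.comm,
          ← Preadditive.comp_sub, sub_sub_cancel, P.d_comp_d_assoc, zero_comp]
      · obtain rfl : k = i - 1 := by lia
        dsimp only
        rw [Pi.single_eq_same, hl, sub_add_cancel])
  exact nonempty_homotopy_zero (fun i j => (S i).1 j) (fun i j h => (S i).2.1 j h)
    fun i j k hij hjk => hS j k hjk i hij

theorem isKPureInjective_of_bounded {I : CochainComplex (ModuleCat.{u} R) ℤ} {b : ℤ}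
    (hb : ∀ i, i < b → IsZero (I.X i)) (hI : ∀ i, IsPureInjective (I.X i)) :
    IsKPureInjective I := by
  refine isKPureInjective_of_homotopy fun Z f hZ => ?_
  let T (i : ℤ) := {s : ∀ j, Z.X i ⟶ I.X j // (∀ j, j + 1 ≠ i → s j = 0) ∧
    ∀ j, j + 1 = i → Z.d j i ≫ (f.f i - s j ≫ I.d j i) = 0}
  let r (i j : ℤ) (s : T i) (t : T j) : Prop :=
    ∀ k, k + 1 = i → s.1 k ≫ I.d k i + Z.d i j ≫ t.1 i = f.f i
  obtain ⟨S, -, hS⟩ := exists_ascendingFamily r b (fun i h => ⟨fun _ => 0, fun _ _ => rfl,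
      fun j _ => (hb i h).eq_of_tgt _ _⟩)
    (fun i j hij hj k hk => (hb i (by lia)).eq_of_tgt _ _) (by
      rintro i j hij ⟨s, hs₀, hs⟩
      obtain ⟨l, hl⟩ := (hZ i).extendsAt (hI i) (i - 1) j (by lia) hij _ (hs (i - 1) (by lia))
      refine ⟨⟨Pi.single i l, fun k hk => Pi.single_eq_of_ne (by lia) _, fun k hk => ?_⟩,
        fun k hk => ?_⟩
      · obtain rfl : k = i := by lia
        rw [Pi.single_eq_same, Preadditive.comp_sub, ← Category.assoc, hl, ← f.comm,
          ← Preadditive.sub_comp, sub_sub_cancel, Category.assoc, I.d_comp_d, comp_zero]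
      · obtain rfl : k = i - 1 := by lia
        dsimp only
        rw [Pi.single_eq_same, hl, add_sub_cancel])
  exact nonempty_homotopy_zero (fun i j => (S i).1 j) (fun i j h => (S i).2.1 j h)
    fun i j k hij hjk => hS j k hjk i hij

end NullHomotopy

/-! ### Existence of pure projective and pure injective resolutions -/

section
variable {R : Type u} [Ring R]

/-- The cochain complex with given terms and differentials. -/
def complexOfFamily (P : ℤ → ModuleCat.{u} R) (δ : ∀ i j, i + 1 = j → (P i ⟶ P j))
    (hδ : ∀ i j k hij hjk, δ i j hij ≫ δ j k hjk = 0) : CochainComplex (ModuleCat.{u} R) ℤ where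
  X := P
  d i j := if h : i + 1 = j then δ i j h else 0
  shape i j h := dif_neg h
  d_comp_d' i j k (hij : i + 1 = j) (hjk : j + 1 = k) := by
    rw [dif_pos hij, dif_pos hjk, hδ]

theorem complexOfFamily_d {P : ℤ → ModuleCat.{u} R} {δ : ∀ i j, i + 1 = j → (P i ⟶ P j)}
    {hδ : ∀ i j k hij hjk, δ i j hij ≫ δ j k hjk = 0} {i j : ℤ} (hij : i + 1 = j) :
    (complexOfFamily P δ hδ).d i j = δ i j hij := dif_pos hij

/-- A term of a pure projective resolution, with its cycles and its augmentation. -/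
structure ProjectiveStage (N : ModuleCat.{u} R) where
  /-- the term -/
  obj : ModuleCat.{u} R
  isPureProjective : IsPureProjective obj
  /-- the cycles -/
  cycles : Submodule R obj
  /-- the augmentation -/
  aug : obj →ₗ[R] N

/-- `s` is a term preceding `t` in a pure projective resolution, where `d` is the differential of
the resolved complex. -/
def ProjectiveStage.Precedes {N N' : ModuleCat.{u} R} (d : N →ₗ[R] N') (s : ProjectiveStage N)
    (t : ProjectiveStage N') : Prop :=
  ∃ δ : s.obj →ₗ[R] t.obj, (∀ x, δ x ∈ t.cycles) ∧ (∀ x, x ∈ s.cycles ↔ δ x = 0) ∧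
    (t.aug ∘ₗ δ = d ∘ₗ s.aug) ∧
    ∀ (Q : ModuleCat.{u} R), IsPureProjective Q → ∀ (x : Q →ₗ[R] t.obj) (y : Q →ₗ[R] N),
      (∀ q, x q ∈ t.cycles) → t.aug ∘ₗ x = d ∘ₗ y →
        ∃ w : Q →ₗ[R] s.obj, δ ∘ₗ w = x ∧ s.aug ∘ₗ w = y

/-- Take a pure projective cover of the pullback `Z` of the cycles of `t` and `N` over `N'`. Lifting
along this cover is exactness of `Hom(Q, -)` on the cone of the augmentation. -/
theorem ProjectiveStage.exists_precedes {N N' : ModuleCat.{u} R} (d : N →ₗ[R] N')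
    (t : ProjectiveStage N') : ∃ s : ProjectiveStage N, s.Precedes d t := by
  let Z : Submodule R (t.cycles × N) :=
    LinearMap.ker ((t.aug ∘ₗ t.cycles.subtype).coprod (-d))
  have hZ (z : t.cycles × N) : z ∈ Z ↔ t.aug z.1 = d z.2 := by
    simp [Z, ← sub_eq_add_neg, sub_eq_zero]
  obtain ⟨P, g, hP, hg, hg'⟩ := exists_pureProjective_cover (R := R) Z
  let δ : P →ₗ[R] t.obj := t.cycles.subtype ∘ₗ LinearMap.fst R _ _ ∘ₗ Z.subtype ∘ₗ g
  refine ⟨⟨P, hP, LinearMap.ker δ, LinearMap.snd R _ _ ∘ₗ Z.subtype ∘ₗ g⟩, δ,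
    fun x => (g x).1.1.2, fun x => Iff.rfl, LinearMap.ext fun x => (hZ _).1 (g x).2, ?_⟩
  intro Q hQ x y hx hxy
  obtain ⟨w, hw⟩ := hQ.exists_lift hg hg' (((x.codRestrict _ hx).prod y).codRestrict Z
    fun q => (hZ _).2 (LinearMap.congr_fun hxy q))
  refine ⟨w, LinearMap.ext fun q => ?_, LinearMap.ext fun q => ?_⟩
  · exact congrArg (fun z : Z => (z.1.1 : t.obj)) (LinearMap.congr_fun hw q)
  · exact congrArg (fun z : Z => z.1.2) (LinearMap.congr_fun hw q)

theorem exists_pureProjective_complex (X : CochainComplex (ModuleCat.{u} R) ℤ) (b : ℤ)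
    (hX : ∀ i, b < i → IsZero (X.X i)) :
    ∃ (P : CochainComplex (ModuleCat.{u} R) ℤ) (π : P ⟶ X), IsPureQuasiIso π ∧
      (∀ i, IsPureProjective (P.X i)) ∧ ∀ i, b < i → IsZero (P.X i) := by
  obtain ⟨S, hS₀, hS⟩ := exists_descendingFamily (T := fun i => ProjectiveStage (X.X i))
    (fun i j s t => s.Precedes (X.d i j).hom t) b
    (fun i _ => ⟨ModuleCat.of R PUnit, isPureProjective_of_subsingleton _, ⊤, 0⟩)
    (fun i j hij hi => by
      have := ModuleCat.subsingleton_of_isZero (hX i hi)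
      refine ⟨0, fun _ => trivial, fun _ => ⟨fun _ => rfl, fun _ => trivial⟩, ?_, ?_⟩
      · rw [LinearMap.comp_zero, LinearMap.comp_zero]
      · intro Q _ x y _ _
        exact ⟨0, LinearMap.ext fun q => rfl, LinearMap.ext fun q => Subsingleton.elim _ _⟩)
    fun i j _ t => t.exists_precedes _
  choose δ hδ₁ hδ₂ hδ₃ hδ₄ using hS
  let P : CochainComplex (ModuleCat.{u} R) ℤ := complexOfFamily (fun i => (S i).obj)
    (fun i j hij => ModuleCat.ofHom (δ i j hij)) fun i j k hij hjk => by
      ext x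
      exact (hδ₂ j k hjk _).1 (hδ₁ i j hij x)
  have hd (i j hij) : (P.d i j).hom = δ i j hij :=
    congrArg ModuleCat.Hom.hom (complexOfFamily_d hij)
  let π : P ⟶ X :=
    { f := fun i => ModuleCat.ofHom (S i).aug
      comm' := fun i j hij => by
        ext x
        exact (LinearMap.congr_fun (hδ₃ i j hij) x).symm.trans
          (congrArg (S j).aug (LinearMap.congr_fun (hd i j hij) x).symm) }
  refine ⟨P, π, (pureExact_iff_liftsAt _).2 fun Q hQ n => ?_, fun i => (S i).isPureProjective,
    fun i hi => ?_⟩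
  · refine liftsAt_mappingCone π Q (n - 1) n (n + 1) (n + 2) (by lia) rfl (by lia) ?_
    intro x y hx hxy
    obtain ⟨w, hw₁, hw₂⟩ := hδ₄ n (n + 1) rfl Q hQ (-x.hom) y.hom
      (fun q => neg_mem ((hδ₂ (n + 1) (n + 2) (by lia) _).2 (by
        rw [← hd]
        exact LinearMap.congr_fun (congrArg ModuleCat.Hom.hom hx) q)))
      (by
        have := congrArg ModuleCat.Hom.hom hxy
        exact LinearMap.ext fun q => (map_neg (S (n + 1)).aug (x.hom q)).trans
          (neg_eq_of_add_eq_zero_right (LinearMap.congr_fun this q)))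
    refine ⟨ModuleCat.ofHom w, 0, ?_, ?_⟩
    · ext q
      exact (LinearMap.congr_fun (hd n (n + 1) rfl) (w q)).trans (LinearMap.congr_fun hw₁ q)
    · rw [zero_comp, add_zero]
      ext1
      exact hw₂
  · have : Subsingleton (S i).obj := by
      rw [hS₀ i hi]
      exact inferInstanceAs (Subsingleton PUnit)
    exact ModuleCat.isZero_of_subsingleton (S i).obj

/-- A term of a pure injective resolution, with its boundaries and its coaugmentation. -/
structure InjectiveStage (N : ModuleCat.{u} R) where
  /-- the term -/
  obj : ModuleCat.{u} R
  isPureInjective : IsPureInjective obj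
  /-- the boundaries -/
  boundaries : Submodule R obj
  /-- the coaugmentation -/
  coaug : N →ₗ[R] obj

/-- `s` is a term preceding `t` in a pure injective resolution, where `d` is the differential of
the resolved complex. -/
def InjectiveStage.Precedes {N N' : ModuleCat.{u} R} (d : N →ₗ[R] N') (s : InjectiveStage N)
    (t : InjectiveStage N') : Prop :=
  ∃ δ : s.obj →ₗ[R] t.obj, (∀ x ∈ s.boundaries, δ x = 0) ∧ LinearMap.range δ = t.boundaries ∧
    (δ ∘ₗ s.coaug = t.coaug ∘ₗ d) ∧
    ∀ (E : ModuleCat.{u} R), IsPureInjective E → ∀ (x : N' →ₗ[R] E) (y : s.obj →ₗ[R] E),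
      (∀ z ∈ s.boundaries, y z = 0) → y ∘ₗ s.coaug = x ∘ₗ d →
        ∃ w : t.obj →ₗ[R] E, w ∘ₗ δ = y ∧ w ∘ₗ t.coaug = x

/-- Dually, embed purely in a pure injective the pushout, over `N`, of `N'` and of `s.obj` modulo
its boundaries. -/
theorem InjectiveStage.exists_precedes {N N' : ModuleCat.{u} R} (d : N →ₗ[R] N')
    (s : InjectiveStage N) : ∃ t : InjectiveStage N', s.Precedes d t := by
  let U : Submodule R (s.obj × N') := s.boundaries.map (LinearMap.inl R _ _) ⊔
    LinearMap.range (s.coaug.prod (-d))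
  obtain ⟨E, g, hE, hg⟩ := exists_pureInjective_embedding (R := R) ((s.obj × N') ⧸ U)
  let δ : s.obj →ₗ[R] E := g ∘ₗ U.mkQ ∘ₗ LinearMap.inl R _ _
  refine ⟨⟨E, hE, LinearMap.range δ, g ∘ₗ U.mkQ ∘ₗ LinearMap.inr R _ _⟩, δ, fun x hx => ?_, rfl,
    LinearMap.ext fun z => ?_, fun E' hE' x y hy hxy => ?_⟩
  · refine (congrArg g ?_).trans (map_zero g)
    exact (Submodule.Quotient.mk_eq_zero _).2 (Submodule.mem_sup_left ⟨x, hx, rfl⟩)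
  · refine congrArg g ((Submodule.Quotient.eq _).2 (Submodule.mem_sup_right ⟨z, ?_⟩))
    simp
  · obtain ⟨w, hw⟩ := hE'.exists_extension hg (U.liftQ (y.coprod x) (by
      refine sup_le ?_ ?_
      · rintro _ ⟨z, hz, rfl⟩
        simpa using hy z hz
      · rintro _ ⟨z, rfl⟩
        simpa [← sub_eq_add_neg, sub_eq_zero] using LinearMap.congr_fun hxy z))
    refine ⟨w, LinearMap.ext fun z => ?_, LinearMap.ext fun z => ?_⟩
    · refine (LinearMap.congr_fun hw (U.mkQ (z, 0))).trans ?_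
      simp
    · refine (LinearMap.congr_fun hw (U.mkQ (0, z))).trans ?_
      simp

theorem exists_pureInjective_complex (X : CochainComplex (ModuleCat.{u} R) ℤ) (b : ℤ)
    (hX : ∀ i, i < b → IsZero (X.X i)) :
    ∃ (I : CochainComplex (ModuleCat.{u} R) ℤ) (ι : X ⟶ I), IsPureQuasiIso ι ∧
      (∀ i, IsPureInjective (I.X i)) ∧ ∀ i, i < b → IsZero (I.X i) := by
  obtain ⟨S, hS₀, hS⟩ := exists_ascendingFamily (T := fun i => InjectiveStage (X.X i))
    (fun i j s t => s.Precedes (X.d i j).hom t) b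
    (fun i _ => ⟨ModuleCat.of R PUnit, isPureInjective_of_subsingleton _, ⊥, 0⟩)
    (fun i j hij hj => by
      have := ModuleCat.subsingleton_of_isZero (hX j hj)
      refine ⟨0, fun _ _ => rfl, LinearMap.range_zero, ?_, ?_⟩
      · rw [LinearMap.zero_comp, LinearMap.zero_comp]
      · intro Q _ x y _ _
        refine ⟨0, LinearMap.ext fun q => ?_, LinearMap.ext fun q => ?_⟩
        · exact (map_zero y).symm
        · rw [Subsingleton.elim q 0, map_zero, map_zero])
    fun i j _ t => t.exists_precedes _
  choose δ hδ₁ hδ₂ hδ₃ hδ₄ using hS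
  let I : CochainComplex (ModuleCat.{u} R) ℤ := complexOfFamily (fun i => (S i).obj)
    (fun i j hij => ModuleCat.ofHom (δ i j hij)) fun i j k hij hjk => by
      ext x
      exact hδ₁ j k hjk _ (hδ₂ i j hij ▸ LinearMap.mem_range_self _ x)
  have hd (i j hij) : (I.d i j).hom = δ i j hij :=
    congrArg ModuleCat.Hom.hom (complexOfFamily_d hij)
  let ι : X ⟶ I :=
    { f := fun i => ModuleCat.ofHom (S i).coaug
      comm' := fun i j hij => by
        ext x
        exact (LinearMap.congr_fun (hd i j hij) _).trans (LinearMap.congr_fun (hδ₃ i j hij) x) }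
  refine ⟨I, ι, (pureExact_iff_extendsAt _).2 fun E hE n => ?_, fun i => (S i).isPureInjective,
    fun i hi => ?_⟩
  · refine extendsAt_mappingCone ι E (n - 1) n (n + 1) (n + 2) (by lia) rfl (by lia) ?_
    intro x y hy hxy
    obtain ⟨w, hw₁, hw₂⟩ := hδ₄ n (n + 1) rfl E hE x.hom y.hom
      (fun z hz => by
        rw [← hδ₂ (n - 1) n (by lia), ← hd] at hz
        obtain ⟨z, rfl⟩ := hz
        exact LinearMap.congr_fun (congrArg ModuleCat.Hom.hom hy) z)
      (congrArg ModuleCat.Hom.hom hxy)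
    refine ⟨0, ModuleCat.ofHom w, ?_, ?_⟩
    · ext z
      exact (congrArg w (LinearMap.congr_fun (hd n (n + 1) rfl) z)).trans
        (LinearMap.congr_fun hw₁ z)
    · rw [comp_zero, sub_zero]
      ext1
      exact hw₂
  · have : Subsingleton (S i).obj := by
      rw [hS₀ i hi]
      exact inferInstanceAs (Subsingleton PUnit)
    exact ModuleCat.isZero_of_subsingleton (S i).obj

end

/-! ### Solutions of integral systems, in modules and in complexes -/

section Solutions

variable {R : Type u} [Ring R] {ι κ : Type} [Fintype ι] [Fintype κ] (r : ι → κ → ℤ)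

/-- The solutions in `M` of a finite homogeneous system of linear equations with integer
coefficients. -/
def solutions (M : Type u) [AddCommGroup M] [Module R M] : Submodule R (κ → M) where
  carrier := {c | ∀ i, ∑ j, r i j • c j = 0}
  zero_mem' := by simp
  add_mem' := fun {x y} hx hy i => by
    simp only [Pi.add_apply, smul_add, Finset.sum_add_distrib, hx i, hy i, add_zero]
  smul_mem' := fun a x hx i => by
    simp only [Pi.smul_apply, smul_comm _ a, ← Finset.smul_sum, hx i, smul_zero]

/-- The relations on `κ → A` dual to a finite homogeneous system with integer coefficients. -/
def dualRelations (A : Type u) [AddCommGroup A] [Module R A] : (ι → A) →ₗ[R] (κ → A) where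
  toFun y j := ∑ i, r i j • y i
  map_add' x y := by
    ext j
    simp [Finset.sum_add_distrib]
  map_smul' a x := by
    ext j
    simp [smul_comm _ a, Finset.smul_sum]

variable {A B : Type u} [AddCommGroup A] [Module R A] [AddCommGroup B] [Module R B]

omit [Fintype κ] in
theorem dualRelations_range_le (f : A →ₗ[R] B) : LinearMap.range (dualRelations (R := R) r A) ≤
    (LinearMap.range (dualRelations (R := R) r B)).comap (f.compLeft κ) := by
  rintro _ ⟨y, rfl⟩
  refine ⟨fun i => f (y i), ?_⟩
  ext j
  simp [dualRelations]

/-- A system in the quotient is a system upstairs with extra unknowns, indexed by `ι' × ι`, for the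
elements whose dual relations are divided out. -/
theorem SolvesSystems.mapQ_dualRelations {f : A →ₗ[R] B} (hf : SolvesSystems f) :
    SolvesSystems (Submodule.mapQ _ _ (f.compLeft κ) (dualRelations_range_le r f)) := by
  classical
  intro ι' κ' _ _ s α β h
  choose α' hα using fun a => Submodule.Quotient.mk_surjective _ (α a)
  choose β' hβ using fun b => Submodule.Quotient.mk_surjective _ (β b)
  have h' : ∀ a, ∑ b, s a b • β' b - f.compLeft κ (α' a) ∈
      LinearMap.range (dualRelations (R := R) r B) := by
    intro a
    rw [← Submodule.Quotient.mk_eq_zero, Submodule.Quotient.mk_sub, sub_eq_zero]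
    simp only [← Submodule.mkQ_apply, map_sum, map_smul]
    simp only [Submodule.mkQ_apply, hβ, h, ← hα]
    rfl
  choose y hy using h'
  obtain ⟨x, hx⟩ := hf (ι' × κ) ((κ' × κ) ⊕ (ι' × ι))
    (fun p => Sum.elim (fun q => if q.2 = p.2 then s p.1 q.1 else 0)
      (fun q => if q.1 = p.1 then -(r q.2 p.2 : R) else 0))
    (fun p => α' p.1 p.2) (Sum.elim (fun q => β' q.1 q.2) (fun q => y q.1 q.2)) (by
      rintro ⟨a, j⟩
      have := congrFun (hy a) j
      simp [dualRelations, Finset.sum_apply] at this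
      simp [Fintype.sum_sum_type, Fintype.sum_prod_type, ite_smul, Int.cast_smul_eq_zsmul, this])
  refine ⟨fun b => Submodule.Quotient.mk fun j => x (Sum.inl (b, j)), fun a => ?_⟩
  rw [← hα]
  simp only [← Submodule.mkQ_apply, ← map_sum, ← map_smul]
  simp only [Submodule.mkQ_apply]
  refine (Submodule.Quotient.eq _).2 ⟨fun i => x (Sum.inr (a, i)), ?_⟩
  ext j
  have := hx (a, j)
  simp [Fintype.sum_sum_type, Fintype.sum_prod_type, ite_smul, Int.cast_smul_eq_zsmul] at this
  simp [dualRelations, ← this]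

/-- Maps from `A` to the solutions in `N` are the maps `A^κ → N` killing the dual relations.
Extending them from `A` to `B` uses the purity just proved. -/
theorem isPureInjective_solutions {N : ModuleCat.{u} R} (hN : IsPureInjective N) :
    IsPureInjective (ModuleCat.of R (solutions (R := R) r N)) := by
  classical
  intro A B C f g hfg h
  let h' (a : A) : κ → N := (h a : solutions (R := R) r N).1
  have h'_add (a b) : h' (a + b) = h' a + h' b :=
    congrArg (Subtype.val : solutions (R := R) r N → κ → N) (map_add h a b)
  have h'_smul (c : R) (a) : h' (c • a) = c • h' a :=
    congrArg (Subtype.val : solutions (R := R) r N → κ → N) (map_smul h c a)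
  have h'_sol (a i) : ∑ j, r i j • h' a j = 0 := (h a : solutions (R := R) r N).2 i
  let φ (j : κ) : A →ₗ[R] N :=
    { toFun := fun a => h' a j
      map_add' := fun a b => congrFun (h'_add a b) j
      map_smul' := fun c a => congrFun (h'_smul c a) j }
  let ψ : (κ → A) →ₗ[R] N := ∑ j, φ j ∘ₗ LinearMap.proj j
  have hψ : LinearMap.range (dualRelations (R := R) r A) ≤ LinearMap.ker ψ := by
    rintro _ ⟨y, rfl⟩
    simp only [LinearMap.mem_ker, ψ, LinearMap.sum_apply, LinearMap.comp_apply,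
      LinearMap.proj_apply, dualRelations, LinearMap.coe_mk, AddHom.coe_mk, map_sum, map_zsmul]
    rw [Finset.sum_comm]
    exact Finset.sum_eq_zero fun i _ => h'_sol (y i) i
  obtain ⟨k, hk⟩ := hN.exists_extension (hfg.solvesSystems.mapQ_dualRelations r)
    (Submodule.liftQ _ ψ hψ)
  let k' (j : κ) : B →ₗ[R] N :=
    k ∘ₗ (LinearMap.range (dualRelations (R := R) r B)).mkQ ∘ₗ LinearMap.single R (fun _ => B) j
  have hk' (b : B) : LinearMap.pi k' b ∈ solutions (R := R) r N := by
    intro i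
    have h₁ : ∑ j, r i j • Pi.single j b = dualRelations (R := R) r B (Pi.single i b) := by
      ext j
      simp [dualRelations, Finset.sum_apply, Pi.single_apply]
    have h₂ : (LinearMap.range (dualRelations (R := R) r B)).mkQ
        (∑ j, r i j • Pi.single j b) = 0 :=
      (Submodule.Quotient.mk_eq_zero _).2 (h₁ ▸ LinearMap.mem_range_self _ _)
    have h₃ := congrArg k h₂
    simpa [map_sum, k'] using h₃
  refine ⟨(LinearMap.pi k').codRestrict _ hk', LinearMap.ext fun a => Subtype.ext ?_⟩
  ext j
  have := LinearMap.congr_fun hk (Submodule.Quotient.mk (Pi.single j a))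
  have h₁ : ψ (Pi.single j a) = h' a j := by
    simp only [ψ, LinearMap.sum_apply, LinearMap.comp_apply, LinearMap.proj_apply]
    rw [Finset.sum_eq_single j]
    · simp [φ]
    · intro j' _ hj
      simp [hj]
    · simp
  refine Eq.trans ?_ (this.trans h₁)
  have h₂ : f.compLeft κ (Pi.single j a) = Pi.single j (f a) := by
    ext j'
    by_cases hj : j' = j
    · subst hj; simp
    · simp [hj]
  change k (Submodule.Quotient.mk (Pi.single j (f a))) = _
  rw [← h₂]
  rfl

variable (Y : CochainComplex (ModuleCat.{u} R) ℤ)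

/-- The complex of solutions of a finite homogeneous system with integer coefficients. -/
def solutionsComplex : CochainComplex (ModuleCat.{u} R) ℤ where
  X n := ModuleCat.of R (solutions (R := R) r (Y.X n))
  d n m := ModuleCat.ofHom (((Y.d n m).hom.compLeft κ).restrict fun c hc i => by
    have := congrArg (Y.d n m).hom (hc i)
    simpa using this)
  shape n m h := by
    ext x q
    change (Y.d n m).hom (x.1 q) = 0
    rw [Y.shape n m h]
    rfl
  d_comp_d' i j k _ _ := by
    ext x q
    exact LinearMap.congr_fun (d_hom_comp (X := Y) i j k) (x.1 q)

/-- The components of a solution. -/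
def solutionsComplex.proj (j : κ) : solutionsComplex r Y ⟶ Y where
  f n := ModuleCat.ofHom (LinearMap.proj j ∘ₗ (solutions (R := R) r (Y.X n)).subtype)
  comm' _ _ _ := rfl

variable {Y}

/-- A system over `R` in the solutions is one larger system in `Y` with unknowns `(b, j)`: the
equations `s` for each `j` together with the equations `r` for each `b`. -/
theorem pureExact_solutionsComplex (hY : PureExact Y) : PureExact (solutionsComplex r Y) := by
  classical
  refine pureExact_of_exactOnSystems fun l m n hlm hmn => ?_
  intro ι' κ' _ _ s c hc hs
  let c' (b : κ') : κ → Y.X m := (c b : solutions (R := R) r (Y.X m)).1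
  have hc' (b j) : (Y.d m n).hom (c' b j) = 0 :=
    congrFun (congrArg (Subtype.val : solutions (R := R) r (Y.X n) → κ → Y.X n) (hc b)) j
  have hs' (a j) : ∑ b, s a b • c' b j = 0 := by
    let ev : solutions (R := R) r (Y.X m) →ₗ[R] Y.X m := LinearMap.proj j ∘ₗ Submodule.subtype _
    exact (map_sum ev _ _).symm.trans (congrArg ev (hs a))
  have hr (b i) : ∑ j, r i j • c' b j = 0 := (c b : solutions (R := R) r (Y.X m)).2 i
  obtain ⟨x, hx, hx'⟩ := exactOnSystems_of_pureExact hY hlm hmn ((ι' × κ) ⊕ (κ' × ι)) (κ' × κ)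
    (Sum.elim (fun p q => if q.2 = p.2 then s p.1 q.1 else 0)
      (fun p q => if q.1 = p.1 then (r p.2 q.2 : R) else 0))
    (fun q => c' q.1 q.2) (fun q => hc' q.1 q.2) (by
      rintro (⟨a, j⟩ | ⟨b, i⟩)
      · simpa [Fintype.sum_prod_type, ite_smul] using hs' a j
      · rw [Fintype.sum_prod_type, Finset.sum_eq_single b]
        · simpa [Int.cast_smul_eq_zsmul] using hr b i
        · intro b' _ hb
          simp [hb]
        · simp)
  refine ⟨fun b => ⟨fun j => x (b, j), fun i => ?_⟩, fun b => ?_, fun a => ?_⟩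
  · have := hx' (Sum.inr (b, i))
    rw [Fintype.sum_prod_type, Finset.sum_eq_single b] at this
    · simpa [Int.cast_smul_eq_zsmul] using this
    · intro b' _ hb
      simp [hb]
    · simp
  · exact Subtype.ext (funext fun j => hx (b, j))
  · refine Subtype.ext (funext fun j => ?_)
    have := hx' (Sum.inl (a, j))
    simp [Fintype.sum_prod_type, ite_smul] at this
    refine Eq.trans ?_ this
    refine (congrFun (map_sum (solutions (R := R) r (Y.X l)).subtype _ _) j).trans ?_
    rw [Finset.sum_apply]
    rfl

end Solutions

/-! ### Pure exactness of Hom complexes over `ℤ` -/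

section Preserves

open CochainComplex CochainComplex.HomComplex

variable {R : Type u} [Ring R] {X Y : CochainComplex (ModuleCat.{u} R) ℤ}

/-- The value of a component of a cochain, as a homomorphism in the cochain. -/
def cochainEval (n p q : ℤ) (hpq : p + n = q) (x : X.X p) : Cochain X Y n →+ Y.X q where
  toFun z := (z.v p q hpq).hom x
  map_zero' := rfl
  map_add' _ _ := rfl

/-- A tuple of cocycles satisfying `r` is one cocycle with values in the complex of solutions.
Bounding it there bounds all components at once, by cochains that again satisfy `r`. -/
theorem exactOnSystems_homComplex (i n k : ℤ) (hi : i + 1 = n) (hk : n + 1 = k)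
    (h : ∀ (ι κ : Type) [Fintype ι] [Fintype κ] (r : ι → κ → ℤ),
      HomVanishes X (solutionsComplex r Y) n) :
    ExactOnSystems ((HomComplex X Y).d i n).hom.toIntLinearMap
      ((HomComplex X Y).d n k).hom.toIntLinearMap := by
  intro ι κ _ _ r c hc hr
  replace hc : ∀ j, δ n k (c j : Cochain X Y n) = 0 := hc
  have hr' : ∀ i, ∑ j, r i j • (c j : Cochain X Y n) = 0 := hr
  have hsol (p q hpq) (x : X.X p) :
      (fun j => ((c j : Cochain X Y n).v p q hpq).hom x) ∈ solutions (R := R) r (Y.X q) := by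
    intro i
    have h₁ := congrArg (cochainEval (X := X) (Y := Y) n p q hpq x) (hr' i)
    refine Eq.trans ?_ h₁
    refine Eq.trans ?_ (map_sum (cochainEval (X := X) (Y := Y) n p q hpq x) _ _).symm
    exact Finset.sum_congr rfl fun j _ =>
      (map_zsmul (cochainEval (X := X) (Y := Y) n p q hpq x) _ _).symm
  let z : Cochain X (solutionsComplex r Y) n := Cochain.mk fun p q hpq =>
    ModuleCat.ofHom ((LinearMap.pi fun j => ((c j : Cochain X Y n).v p q hpq).hom).codRestrict _
      (hsol p q hpq))
  have hz (j : κ) : z.comp (Cochain.ofHom (solutionsComplex.proj r Y j)) (add_zero n) = c j := by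
    ext p q hpq x
    simp [z]
    rfl
  have hext (m : ℤ) (a b : Cochain X (solutionsComplex r Y) m)
      (hab : ∀ j, a.comp (Cochain.ofHom (solutionsComplex.proj r Y j)) (add_zero m) =
        b.comp (Cochain.ofHom (solutionsComplex.proj r Y j)) (add_zero m)) : a = b := by
    ext p q hpq x
    refine Subtype.ext (funext fun j => ?_)
    have := Cochain.congr_v (hab j) p q hpq
    simp only [Cochain.comp_zero_cochain_v, Cochain.ofHom_v] at this
    exact LinearMap.congr_fun (congrArg ModuleCat.Hom.hom this) x
  have hδz : δ n k z = 0 := hext k _ _ fun j => by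
    rw [← δ_comp_ofHom, hz, hc, Cochain.zero_comp]
  obtain ⟨β, hβ⟩ := (mem_coboundaries_iff _ i hi).1 (h ι κ r (Cocycle.mk z k hk hδz))
  replace hβ : δ i n β = z := hβ
  refine ⟨fun j => β.comp (Cochain.ofHom (solutionsComplex.proj r Y j)) (add_zero i),
    fun j => ?_, fun a => ?_⟩
  · refine Eq.trans (δ_comp_ofHom β (solutionsComplex.proj r Y j) n) ?_
    rw [hβ, hz]
  · change ∑ j, r a j • (β.comp (Cochain.ofHom (solutionsComplex.proj r Y j)) (add_zero i)) = 0
    ext p q hpq x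
    refine Eq.trans (map_sum (cochainEval (Y := Y) i p q hpq x) _ _) ?_
    simp only [map_zsmul]
    refine Eq.trans (Finset.sum_congr rfl fun j _ => congrArg (r a j • ·) ?_)
      (((β.v p q hpq).hom x : solutions (R := R) r (Y.X q)).2 a)
    change ((β.comp (Cochain.ofHom (solutionsComplex.proj r Y j)) (add_zero i)).v p q hpq).hom x = _
    rw [Cochain.comp_zero_cochain_v, Cochain.ofHom_v]
    rfl

theorem pureExactAb_homComplex
    (h : ∀ (ι κ : Type) [Fintype ι] [Fintype κ] (r : ι → κ → ℤ) (n : ℤ),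
      HomVanishes X (solutionsComplex r Y) n) : PureExactAb (HomComplex X Y) := by
  intro n
  have hd (i j k : ℤ) : ((HomComplex X Y).d j k).hom.toIntLinearMap ∘ₗ
      ((HomComplex X Y).d i j).hom.toIntLinearMap = 0 :=
    LinearMap.ext fun z => δ_δ i j k z
  exact isPureExactPair_of_exactOnSystems (hd _ _ _) (hd _ _ (n + 1 + 1)) (hd _ _ (n + 1 + 1 + 1))
    (exactOnSystems_homComplex _ _ _ (by lia) rfl fun ι κ _ _ r => h ι κ r _)
    (exactOnSystems_homComplex _ _ _ rfl rfl fun ι κ _ _ r => h ι κ r _)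
    (exactOnSystems_homComplex _ _ _ rfl rfl fun ι κ _ _ r => h ι κ r _)

theorem IsKPureProjective.pureExactAb (hX : IsKPureProjective X) (hY : PureExact Y) :
    PureExactAb (HomComplex X Y) :=
  pureExactAb_homComplex fun _ _ _ _ r n => hX.homVanishes (pureExact_solutionsComplex r hY) n

/-- Being bounded below with pure injective terms passes to the complex of solutions, which is
therefore K-pure injective. -/
theorem pureExactAb_homComplex_of_isPureInjective {b : ℤ} (hX : PureExact X)
    (hb : ∀ i, i < b → IsZero (Y.X i)) (hY : ∀ i, IsPureInjective (Y.X i)) :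
    PureExactAb (HomComplex X Y) := by
  refine pureExactAb_homComplex fun ι κ _ _ r n => ?_
  refine (isKPureInjective_of_bounded (b := b) (fun i hi => ?_)
    fun i => isPureInjective_solutions r (hY i)).homVanishes hX n
  have := ModuleCat.subsingleton_of_isZero (hb i hi)
  have : Subsingleton (solutions (R := R) r (Y.X i)) := inferInstance
  exact ModuleCat.isZero_of_subsingleton (ModuleCat.of R (solutions (R := R) r (Y.X i)))

theorem homVanishes_of_pureExactAb {n : ℤ} (h : PureExactAb (HomComplex X Y)) :
    HomVanishes X Y n := by
  intro z
  obtain ⟨β, hβ⟩ := ((h n).ker_eq (z : Cochain X Y n)).1 (z.δ_eq_zero (n + 1))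
  exact (mem_coboundaries_iff _ (n - 1) (by lia)).2 ⟨β, hβ⟩

theorem PureProjectiveResolution.isKPureProjective (P : PureProjectiveResolution X) :
    IsKPureProjective P.complex :=
  isKPureProjective_of_homVanishes fun Z hZ => homVanishes_of_pureExactAb (P.preserves Z hZ)

theorem PureInjectiveResolution.isKPureInjective (I : PureInjectiveResolution X) :
    IsKPureInjective I.complex :=
  isKPureInjective_of_homVanishes fun Z hZ => homVanishes_of_pureExactAb (I.preserves Z hZ)

end Preserves

/-! ### Dimension bounds, and their translation to the extended line -/

section Dimensions

open CochainComplex CochainComplex.HomComplex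

variable {R : Type u} [Ring R] {X Y : CochainComplex (ModuleCat.{u} R) ℤ}

theorem pureExactAt_of_isZero {k : ℤ} (h : IsZero (X.X k)) : PureExactAt X k := by
  have := ModuleCat.subsingleton_of_isZero h
  -- Pure exactness at `k` involves only the two maps at `k`. Continuing them by `id` and `0`
  -- instead of the differentials of `X` makes the two auxiliary spots trivially exact.
  refine isPureExactPair_of_exactOnSystems (d₂ := (LinearMap.id : X.X (k + 1) →ₗ[R] X.X (k + 1)))
    (d₃ := (0 : X.X (k + 1) →ₗ[R] X.X (k + 1))) ?_ ?_ ?_ ?_ ?_ ?_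
  · exact LinearMap.ext fun x => by simp [Subsingleton.elim ((X.d (k - 1) k).hom x) 0]
  · exact LinearMap.ext fun x => by simp [Subsingleton.elim x 0]
  · exact LinearMap.ext fun x => by simp
  · exact fun ι κ _ _ r c _ _ => ⟨0, fun j => Subsingleton.elim _ _, fun i => by simp⟩
  · intro ι κ _ _ r c hc _
    exact ⟨0, fun j => by simpa using (hc j).symm, fun i => by simp⟩
  · exact fun ι κ _ _ r c _ hr => ⟨c, fun j => rfl, hr⟩

theorem homVanishes_of_isZero {n : ℤ}
    (h : ∀ p q, p + n = q → IsZero (X.X p) ∨ IsZero (Y.X q)) : HomVanishes X Y n := by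
  intro z
  have : z = 0 := by
    refine Subtype.ext (Cochain.ext _ _ fun p q hpq => ?_)
    obtain h | h := h p q hpq
    · exact h.eq_of_src _ _
    · exact h.eq_of_tgt _ _
  rw [this]
  exact zero_mem _

theorem isZero_single₀ (M : ModuleCat.{u} R) {i : ℤ} (hi : i ≠ 0) : IsZero ((single₀ M).X i) :=
  HomologicalComplex.isZero_single_obj_X _ _ _ _ hi

theorem isBounded_single₀ (M : ModuleCat.{u} R) : IsBounded (single₀ M) :=
  ⟨0, 0, fun _ hi => isZero_single₀ M (by lia)⟩

theorem HasPpdLE.mono {m n : ℤ} (h : HasPpdLE X m) (hmn : m ≤ n) : HasPpdLE X n :=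
  h.imp fun _ hP i hi => hP i (by lia)

theorem HasPidLE.mono {m n : ℤ} (h : HasPidLE X m) (hmn : m ≤ n) : HasPidLE X n :=
  h.imp fun _ hI i hi => hI i (by lia)

/-- For each module `C`, `key` passes from `Hom(C, I)` to `Hom(P, τ_{≤ s} Y)`, whose cochains in
degrees `> n + s` are zero. The degree `n + s + 1` makes the terms of the truncation pure injective;
all degrees above `n + s` make its inclusion a pure quasi-isomorphism. -/
theorem hasPidLE_of_forall_single {n : ℤ} (h : ∀ M : ModuleCat.{u} R, HasPpdLE (single₀ M) n)
    (hY : IsBounded Y) {s : ℤ} (hs : ∀ k, s < k → PureExactAt Y k) : HasPidLE Y (n + s) := by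
  obtain ⟨a, b, hab⟩ := hY
  obtain ⟨I, ι, hι, hI, hIa⟩ := exists_pureInjective_complex Y a fun i hi => hab i (.inl hi)
  have hK := isKPureInjective_of_bounded hIa hI
  have key (C : ModuleCat.{u} R) (k : ℤ) (hk : n + s < k) : LiftsAt C I k := by
    obtain ⟨P, hP⟩ := h C
    have hPK := P.isKPureProjective
    rw [← homVanishes_single_left, ← hK.homVanishes_iff P.isPureQuasiIso,
      ← hPK.homVanishes_iff hι, ← hPK.homVanishes_iff (isPureQuasiIso_truncLE (s := s)
        fun Q hQ j hj => (hs j hj).liftsAt hQ)]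
    refine homVanishes_of_isZero fun p q hpq => ?_
    by_cases hp : p < -n
    · exact .inl (hP p hp)
    · exact .inr (isZero_truncLE (by lia))
  have hI' := isPureInjective_truncLE hI fun C => key C (n + s + 1) (by lia)
  have hI'a (i : ℤ) (hi : i < a) : IsZero ((truncLE I (n + s)).X i) := by
    have := ModuleCat.subsingleton_of_isZero (hIa i hi)
    have : Subsingleton (truncLESubmodule I (n + s) i) := inferInstance
    exact ModuleCat.isZero_of_subsingleton (ModuleCat.of R (truncLESubmodule I (n + s) i))
  obtain ⟨ι', hι'⟩ := hK.exists_pureQuasiIso (isKPureInjective_of_bounded hI'a hI') hι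
    (isPureQuasiIso_truncLE fun C _ k hk => key C k hk)
  exact ⟨⟨_, ι', hι', hI', fun Z hZ => pureExactAb_homComplex_of_isPureInjective hZ hI'a hI'⟩,
    fun i hi => isZero_truncLE hi⟩

/-- The cohomology is that of `Hom(τ_{≥ c} X, I)`. A component of degree `> m - c` starts below `c`
or ends above `m`. -/
theorem homVanishes_of_hasPidLE {m c i : ℤ} (hY : HasPidLE Y m)
    (hc : ∀ k, k < c → PureExactAt X k) (P : PureProjectiveResolution X) (hi : m - c < i) :
    HomVanishes P.complex Y i := by
  obtain ⟨I, hI⟩ := hY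
  have hIK := I.isKPureInjective
  rw [P.isKPureProjective.homVanishes_iff I.isPureQuasiIso, hIK.homVanishes_iff P.isPureQuasiIso,
    hIK.homVanishes_iff (isPureQuasiIso_truncGE (s := c) fun E hE j hj => (hc j hj).extendsAt hE)]
  refine homVanishes_of_isZero fun p q hpq => ?_
  by_cases hp : p < c
  · exact .inl (isZero_truncGE hp)
  · exact .inr (hI q (by lia))

/-- For a bounded above resolution `P`, vanishing against every module makes the cokernel in degree
`-m` pure projective and `P → τ_{≥ -m} P` a pure quasi-isomorphism, along which `P → X` is
transported. -/
theorem hasPpdLE_of_homVanishes {m : ℤ} (hX : IsBounded X)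
    (h : ∀ (P : PureProjectiveResolution X) (N : ModuleCat.{u} R) (k : ℤ), m < k →
      HomVanishes P.complex (single₀ N) k) : HasPpdLE X m := by
  obtain ⟨a, b, hab⟩ := hX
  obtain ⟨P, π, hπ, hP, hPb⟩ := exists_pureProjective_complex X b fun i hi => hab i (.inr hi)
  have hK := isKPureProjective_of_bounded hPb hP
  have key (N : ModuleCat.{u} R) (j : ℤ) (hj : j < -m) : ExtendsAt N P j :=
    (homVanishes_single_right N (add_neg_cancel j)).1
      (h ⟨P, π, hπ, hP, fun _ hZ => hK.pureExactAb hZ⟩ N (-j) (by lia))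
  have hP' := isPureProjective_truncGE hP fun N => key N (-m - 1) (by lia)
  have hP'b (i : ℤ) (hi : b < i) : IsZero ((truncGE P (-m)).X i) := by
    have := ModuleCat.subsingleton_of_isZero (hPb i hi)
    have : Subsingleton (P.X i ⧸ truncGESubmodule P (-m) i) :=
      (Submodule.mkQ_surjective _).subsingleton
    exact ModuleCat.isZero_of_subsingleton (ModuleCat.of R (P.X i ⧸ truncGESubmodule P (-m) i))
  have hK' := isKPureProjective_of_bounded hP'b hP'
  obtain ⟨π', hπ'⟩ := hK.exists_pureQuasiIso hK' hπ
    (isPureQuasiIso_truncGE fun N _ k hk => key N k hk)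
  exact ⟨⟨_, π', hπ', hP', fun Z hZ => hK'.pureExactAb hZ⟩, fun i hi => isZero_truncGE hi⟩

theorem iInf_int_le_iff {F : ℤ → Prop} (hF : ∀ m n, F m → m ≤ n → F n) (m : ℤ) :
    ⨅ (n : ℤ) (_ : F n), ((n : ℝ) : EReal) ≤ ((m : ℝ) : EReal) ↔ F m := by
  refine ⟨fun h => ?_, fun h => iInf₂_le m h⟩
  by_contra hm
  have h₁ : (((m + 1 : ℤ) : ℝ) : EReal) ≤ ⨅ (n : ℤ) (_ : F n), ((n : ℝ) : EReal) := by
    refine le_iInf₂ fun n hn => ?_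
    have : m < n := lt_of_not_ge fun hnm => hm (hF n m hn hnm)
    exact_mod_cast Int.add_one_le_iff.2 this
  have h₂ : m + 1 ≤ m := by exact_mod_cast h₁.trans h
  lia

theorem ppd_le_iff (m : ℤ) : ppd X ≤ ((m : ℝ) : EReal) ↔ HasPpdLE X m :=
  iInf_int_le_iff (fun _ _ => HasPpdLE.mono) m

theorem pid_le_iff (m : ℤ) : pid X ≤ ((m : ℝ) : EReal) ↔ HasPidLE X m :=
  iInf_int_le_iff (fun _ _ => HasPidLE.mono) m

theorem le_infP_iff (c : ℤ) : ((c : ℝ) : EReal) ≤ infP X ↔ ∀ k, k < c → PureExactAt X k := by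
  simp only [infP, le_iInf_iff, EReal.coe_le_coe_iff, Int.cast_le]
  exact forall_congr' fun k => by rw [not_imp_comm, not_le]

theorem supP_le_iff (s : ℤ) : supP X ≤ ((s : ℝ) : EReal) ↔ ∀ k, s < k → PureExactAt X k := by
  simp only [supP, iSup_le_iff, EReal.coe_le_coe_iff, Int.cast_le]
  exact forall_congr' fun k => by rw [not_imp_comm, not_le]

theorem IsBounded.exists_le_infP (hX : IsBounded X) : ∃ c : ℤ, ((c : ℝ) : EReal) ≤ infP X := by
  obtain ⟨a, b, hab⟩ := hX
  exact ⟨a, (le_infP_iff a).2 fun k hk => pureExactAt_of_isZero (hab k (.inl hk))⟩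

theorem IsBounded.exists_supP_le (hX : IsBounded X) : ∃ s : ℤ, supP X ≤ ((s : ℝ) : EReal) := by
  obtain ⟨a, b, hab⟩ := hX
  exact ⟨b, (supP_le_iff b).2 fun k hk => pureExactAt_of_isZero (hab k (.inr hk))⟩

/-- The condition on `c` bounds the integers below `c` rather than `c` itself, so `c = ⌈x⌉` is
allowed and `x` need not be known to be an integer. At `x = ⊤` every `c` qualifies and forces `y =
⊥`. -/
theorem le_int_sub {n : ℤ} {x y : EReal}
    (h : ∀ c : ℤ, (∀ m : ℤ, m < c → ((m : ℝ) : EReal) < x) → y ≤ (((n - c : ℤ) : ℝ) : EReal)) :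
    y ≤ ((n : ℝ) : EReal) - x := by
  induction x with
  | bot => simp
  | coe r =>
    refine (h ⌈r⌉ fun m hm => EReal.coe_lt_coe_iff.2 (Int.lt_ceil.1 hm)).trans ?_
    rw [← EReal.coe_sub, EReal.coe_le_coe_iff, Int.cast_sub]
    exact sub_le_sub_left (Int.le_ceil r) _
  | top =>
    rw [EReal.sub_top, le_bot_iff, EReal.eq_bot_iff_forall_lt]
    intro t
    refine (h (n - ⌊t⌋ + 1) fun m _ => EReal.coe_lt_top _).trans_lt (EReal.coe_lt_coe_iff.2 ?_)
    rw [show n - (n - ⌊t⌋ + 1) = ⌊t⌋ - 1 by ring]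
    exact lt_of_lt_of_le (by exact_mod_cast sub_one_lt ⌊t⌋) (Int.floor_le t)

theorem le_int_add {n : ℤ} {x y : EReal}
    (h : ∀ s : ℤ, (∀ m : ℤ, s < m → x < ((m : ℝ) : EReal)) → y ≤ (((n + s : ℤ) : ℝ) : EReal)) :
    y ≤ ((n : ℝ) : EReal) + x := by
  have := le_int_sub (n := n) (x := -x) (y := y) fun c hc => by
    refine (h (-c) fun m hm => ?_).trans_eq (by rw [sub_eq_add_neg])
    have := EReal.neg_lt_neg_iff.2 (hc (-m) (by lia))
    simpa using this
  rwa [sub_eq_add_neg, neg_neg] at this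

/-- The finite bounds `c₀` and `s₀` rule out `x = ⊥` and `y = ⊤`. If `x = ⊤` or `y = ⊥`, the complex
is pure exact in the intended use, and `c` or `s` is pushed far enough to satisfy the last
inequality. -/
theorem exists_int_bounds {n i : ℤ} {x y : EReal} {c₀ s₀ : ℤ} (hx : ((c₀ : ℝ) : EReal) ≤ x)
    (hy : y ≤ ((s₀ : ℝ) : EReal)) (h : ((n : ℝ) : EReal) + y - x < ((i : ℝ) : EReal)) :
    ∃ c s : ℤ, (∀ m : ℤ, m < c → ((m : ℝ) : EReal) < x) ∧
      (∀ m : ℤ, s < m → y < ((m : ℝ) : EReal)) ∧ n + s - c < i := by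
  have hlt {a b : ℤ} (hab : a < b) : ((a : ℝ) : EReal) < ((b : ℝ) : EReal) := by exact_mod_cast hab
  induction x with
  | bot => simp at hx
  | top =>
    exact ⟨n + s₀ - i + 1, s₀, fun m _ => EReal.coe_lt_top _, fun m hm => hy.trans_lt (hlt hm),
      by lia⟩
  | coe r =>
    induction y with
    | top => simp at hy
    | bot =>
      exact ⟨c₀, i - n + c₀ - 1, fun m hm => (hlt hm).trans_le hx, fun m _ => EReal.bot_lt_coe _,
        by lia⟩
    | coe t =>
      refine ⟨⌈r⌉, ⌊t⌋, fun m hm => EReal.coe_lt_coe_iff.2 (Int.lt_ceil.1 hm),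
        fun m hm => EReal.coe_lt_coe_iff.2 (Int.floor_lt.1 hm), ?_⟩
      rw [← EReal.coe_add, ← EReal.coe_sub, EReal.coe_lt_coe_iff] at h
      have h₁ := Int.le_ceil r
      have h₂ := Int.floor_le t
      have : ((n + ⌊t⌋ - ⌈r⌉ : ℤ) : ℝ) < i := by push_cast; linarith
      exact_mod_cast this

theorem pureExactAt_of_lt_infP {k : ℤ} (h : ((k : ℝ) : EReal) < infP X) : PureExactAt X k := by
  by_contra hk
  exact (iInf₂_le (f := fun (n : ℤ) (_ : ¬ PureExactAt X n) => ((n : ℝ) : EReal)) k hk).not_gt h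

theorem pureExactAt_of_supP_lt {k : ℤ} (h : supP X < ((k : ℝ) : EReal)) : PureExactAt X k := by
  by_contra hk
  exact (le_iSup₂ (f := fun (n : ℤ) (_ : ¬ PureExactAt X n) => ((n : ℝ) : EReal)) k hk).not_gt h

theorem pureGlobalDim_le_iff (n : ℤ) : pureGlobalDim R ≤ ((n : ℝ) : EReal) ↔
    ∀ M : ModuleCat.{u} R, HasPpdLE (single₀ M) n :=
  iSup_le_iff.trans (forall_congr' fun _ => ppd_le_iff n)

end Dimensions

end PureDerived

end

theorem theorem4p7 {R : Type u} [Ring R] (n : ℤ) :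
    List.TFAE [
      PureDerived.pureGlobalDim R ≤ ((n : ℝ) : EReal),
      ∀ X : CochainComplex (ModuleCat.{u} R) ℤ, PureDerived.IsBounded X →
        PureDerived.ppd X ≤ ((n : ℝ) : EReal) - PureDerived.infP X,
      ∀ Y : CochainComplex (ModuleCat.{u} R) ℤ, PureDerived.IsBounded Y →
        PureDerived.pid Y ≤ ((n : ℝ) : EReal) + PureDerived.supP Y,
      ∀ X Y : CochainComplex (ModuleCat.{u} R) ℤ,
        PureDerived.IsBounded X → PureDerived.IsBounded Y →
        ∀ (P : PureDerived.PureProjectiveResolution X) (i : ℤ),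
          ((n : ℝ) : EReal) + PureDerived.supP Y - PureDerived.infP X < ((i : ℝ) : EReal) →
          CategoryTheory.Limits.IsZero (P.Pext Y i)] := by
  open PureDerived in
  tfae_have 1 → 3 := fun h Y hY => le_int_add fun s hs =>
    (pid_le_iff _).2 (hasPidLE_of_forall_single ((pureGlobalDim_le_iff n).1 h) hY
      fun k hk => pureExactAt_of_supP_lt (hs k hk))
  tfae_have 3 → 4 := by
    intro h X Y hX hY P i hi
    obtain ⟨c₀, hc₀⟩ := hX.exists_le_infP
    obtain ⟨s₀, hs₀⟩ := hY.exists_supP_le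
    obtain ⟨c, s, hc, hs, hcs⟩ := exists_int_bounds hc₀ hs₀ hi
    have hY' : HasPidLE Y (n + s) := by
      rw [← pid_le_iff, Int.cast_add, EReal.coe_add]
      refine (h Y hY).trans (add_le_add le_rfl ?_)
      exact (supP_le_iff s).2 fun k hk => pureExactAt_of_supP_lt (hs k hk)
    exact homVanishes_iff_isZero.1 (homVanishes_of_hasPidLE hY'
      (fun k hk => pureExactAt_of_lt_infP (hc k hk)) P hcs)
  -- Only modules in degree `0` are needed as second argument; their `sup_p` is at most `0`.
  tfae_have 4 → 2 := fun h X hX => le_int_sub fun c hc =>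
    (ppd_le_iff _).2 (hasPpdLE_of_homVanishes hX fun P N k hk => homVanishes_iff_isZero.2 (by
      refine h X _ hX (isBounded_single₀ N) P k ?_
      have h₁ : supP (single₀ N) ≤ (((0 : ℤ) : ℝ) : EReal) :=
        (supP_le_iff 0).2 fun j hj => pureExactAt_of_isZero (isZero_single₀ N hj.ne')
      have h₂ : ((c : ℝ) : EReal) ≤ infP X :=
        (le_infP_iff c).2 fun j hj => pureExactAt_of_lt_infP (hc j hj)
      refine (EReal.sub_le_sub (add_le_add le_rfl h₁) h₂).trans_lt ?_
      rw [← EReal.coe_add, ← EReal.coe_sub, EReal.coe_lt_coe_iff]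
      exact_mod_cast (by lia : n + 0 - c < k)))
  tfae_have 2 → 1 := fun h => (pureGlobalDim_le_iff n).2 fun M => by
    rw [← ppd_le_iff]
    refine (h _ (isBounded_single₀ M)).trans ?_
    have h₂ : (((0 : ℤ) : ℝ) : EReal) ≤ infP (single₀ M) :=
      (le_infP_iff 0).2 fun j hj => pureExactAt_of_isZero (isZero_single₀ M hj.ne)
    refine (EReal.sub_le_sub le_rfl h₂).trans (le_of_eq ?_)
    simp
  tfae_finish
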